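/- **Setting.** For a Hermitian $N\times N$ matrix $H$ let $D=D_H$ be the self-adjoint operator on $M_N(\mathbb C)$ given by $D=\{H,\cdot\}$ (type $(1,0)$), or by $D=-i[L,\cdot]$ with $L=iH$ skew-Hermitian (type $(0,1)$). Let $$S(D)=\tfrac12 D^2+\sum_{j=2}^{d}\frac{t_{2j}}{2j}D^{2j},$$ and consider the Dirac ensemble $Z=\int e^{-\frac12 \mathrm{tr}\, S(D)}\,dD$, that is, the bitracial Hermitian matrix model with weight $e^{-\frac12\mathrm{tr}\,S(D_H)}\,dH$. It is understood as a formal matrix integral. Write $$\tfrac12\mathrm{tr}\,S(D)=\tfrac N2\mathrm{tr}\,H^2+s\big(\tfrac14 \mathrm{tr}\,D^2-\tfrac N2 \mathrm{tr}\,H^2\big)+\sum_{j=2}^{d}\frac{t_{2j}}{4j}\mathrm{tr}\,D^{2j}\quad\text{at } s=1$$ (the bracket multiplying $s$ is $\pm\frac12(\mathrm{tr}\,H)^2$). Expand all of the exponential except $e^{-\frac N2\mathrm{tr}H^2}$ in powers of the formal variables $s,t_4,\dots,t_{2d}$, integrate term by term against the Gaussian weight $e^{-\frac N2\mathrm{tr}H^2}dH$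 on Hermitian matrices, and divide by the resulting series $Z$. This gives the formal expectations $\langle f(H)\rangle\in\mathbb R[[s,t_4,\dots,t_{2d}]]$. The formal limiting moments of $H$ and of $D$ are the coefficientwise limits, when they exist, $$m_\ell=\lim_{N\to\infty}\tfrac1N\langle \mathrm{tr}\,H^\ell\rangle,\qquad \zeta_\ell=\lim_{N\to\infty}\tfrac1{N^2}\langle \mathrm{tr}\,D^\ell\rangle .$$ A probability density $\rho$ on $\mathbb R$ with finite moments is a *limiting eigenvalue density* of $H$ (in the formal sense) at real coupling constants $t_{2j}$ if all $m_\ell$ exist and each series $m_\ell$, evaluated at $s=1$ and these $t_{2j}$, converges (unconditionally) to $\int x^\ell\rho(x)\,dx$. Limiting spectral densities of $D$ are defined in the same way from $\zeta_\ell$. **Theorem 2.1.** Consider a type $(1,0)$ or $(0,1)$ Dirac ensemble as above. 1. If the formal limiting moments $m_\ell$ exist for all $\ell$, then so do all $\zeta_\ell$, and $\zeta_\ell=\sum_{k=0}^{\ell}\binom{\ell}{k}m_{\ell-k}m_k$ as formal power series; that is, the formal limiting distribution of $D$ is the self-convolution of that of $H$. 2. If, at given real coupling constants, the associated formal matrix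 model has a limiting eigenvalue density $\rho$, then at these coupling constants the self-convolution $$\rho_D(x)=\int_{\mathbb R}\rho(x-u)\,\rho(u)\,du$$ (the integral converges absolutely for almost every $x$) is a limiting spectral density of $D$. If $\rho$ has compact support, it is the only one up to equality almost everywhere. -/

import Mathlib

open Filter Topology MeasureTheory

noncomputable section

namespace DiracEnsemble

/-- The two types of matrix geometry with a single gamma matrix:
`oneZero` is type `(1,0)`, with `γ¹ = 1`; `zeroOne` is type `(0,1)`, with `γ¹ = -i`. -/
inductive GeomType where
  | oneZero
  | zeroOne

/-- The Dirac operator attached to the Hermitian matrix `H`, acting on `ℂ ⊗ M_N(ℂ) = M_N(ℂ)`.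
Type `(1,0)`: `D = {H, ·}`. Type `(0,1)`: `D = γ¹ ⊗ [L, ·] = -i [L, ·]`, with the skew-Hermitian
matrix `L` written as `L = i H`. -/
def diracOp (τ : GeomType) {N : ℕ} (H : Matrix (Fin N) (Fin N) ℂ) :
    Module.End ℂ (Matrix (Fin N) (Fin N) ℂ) :=
  match τ with
  | .oneZero => LinearMap.mulLeft ℂ H + LinearMap.mulRight ℂ H
  | .zeroOne => (-Complex.I) •
      (LinearMap.mulLeft ℂ (Complex.I • H) - LinearMap.mulRight ℂ (Complex.I • H))

/-- `tr H ^ ℓ`, a real number when `H` is Hermitian. -/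
def matTr {N : ℕ} (H : Matrix (Fin N) (Fin N) ℂ) (ℓ : ℕ) : ℝ :=
  (Matrix.trace (H ^ ℓ)).re

/-- `tr D ^ ℓ`, the trace over the `N²`-dimensional space `M_N(ℂ)`; it is real because `D` is
self-adjoint. -/
def diracTr (τ : GeomType) {N : ℕ} (H : Matrix (Fin N) (Fin N) ℂ) (ℓ : ℕ) : ℝ :=
  (LinearMap.trace ℂ (Matrix (Fin N) (Fin N) ℂ) (diracOp τ H ^ ℓ)).re

/-- The operator `S(D) = D² / 2 + ∑_{j=2}^{d} (t_{2j} / 2j) D^{2j}`; `t j` stands for `t_{2j}`. -/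
def actionOp (d : ℕ) (t : ℕ → ℝ) (τ : GeomType) {N : ℕ} (H : Matrix (Fin N) (Fin N) ℂ) :
    Module.End ℂ (Matrix (Fin N) (Fin N) ℂ) :=
  (1 / 2 : ℂ) • diracOp τ H ^ 2 +
    ∑ j ∈ Finset.Icc 2 d, ((t j : ℂ) / (2 * j)) • diracOp τ H ^ (2 * j)

/-- The exponent `tr S(D) / 2` of the Dirac ensemble with weight `exp (- tr S(D) / 2) dD`. -/
def potential (d : ℕ) (t : ℕ → ℝ) (τ : GeomType) {N : ℕ} (H : Matrix (Fin N) (Fin N) ℂ) : ℝ :=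
  1 / 2 * (LinearMap.trace ℂ (Matrix (Fin N) (Fin N) ℂ) (actionOp d t τ H)).re

/-- The Hermitian matrix with real coordinates `x`: diagonal entries `x i i`, and entries
`x i j + i x j i` above the diagonal. -/
def herm {N : ℕ} (x : Fin N → Fin N → ℝ) : Matrix (Fin N) (Fin N) ℂ :=
  Matrix.of fun i j =>
    if i < j then ⟨x i j, x j i⟩ else if j < i then ⟨x j i, -x i j⟩ else ⟨x i i, 0⟩

/-- The coordinates `herm` run through every Hermitian matrix exactly once. -/
theorem herm_bijOn (N : ℕ) :
    Set.BijOn (herm (N := N)) Set.univ {H | H.IsHermitian} := by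
  refine ⟨?_, ?_, ?_⟩
  · intro x _
    refine Matrix.IsHermitian.ext fun i j => ?_
    rcases lt_trichotomy i j with h | h | h
    · simp [herm, h, h.not_gt, Complex.ext_iff]
    · subst h; simp [herm, Complex.ext_iff]
    · simp [herm, h, h.not_gt, Complex.ext_iff]
  · intro x _ y _ hxy
    funext i j
    rcases lt_trichotomy i j with h | h | h
    · have := congrArg Complex.re (congrFun (congrFun hxy i) j)
      simpa [herm, h] using this
    · subst h
      have := congrArg Complex.re (congrFun (congrFun hxy i) i)
      simpa [herm] using this
    · have := congrArg Complex.im (congrFun (congrFun hxy j) i)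
      simpa [herm, h] using this
  · intro H hH
    refine ⟨fun i j => if i < j then (H i j).re else if j < i then (H j i).im else (H i i).re,
      trivial, ?_⟩
    ext i j
    have hij : star (H j i) = H i j := hH.apply i j
    rcases lt_trichotomy i j with h | h | h
    · simp [herm, h, h.not_gt]
    · subst h
      have := congrArg Complex.im hij
      simp only [RCLike.star_def, Complex.conj_im] at this
      simp [herm, Complex.ext_iff]
      linarith
    · rw [← hij]
      simp [herm, h, h.not_gt, Complex.ext_iff]

/-- The expectation `⟨f⟩₀` in the Gaussian model `exp (- (N / 2) tr H²) dH` on Hermitian `N × N`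
matrices, where `dH` is the Lebesgue measure. -/
def gaussExp (N : ℕ) (f : Matrix (Fin N) (Fin N) ℂ → ℝ) : ℝ :=
  (∫ x : Fin N → Fin N → ℝ, f (herm x) * Real.exp (-((N : ℝ) / 2 * matTr (herm x) 2))) /
    ∫ x : Fin N → Fin N → ℝ, Real.exp (-((N : ℝ) / 2 * matTr (herm x) 2))

/-- The formal parameters of the model: `some j` is the coupling `t_{2j}` with `2 ≤ j ≤ d`, and
`none` is the coupling of the quadratic double-trace term `± (tr H)² / 2`. -/
abbrev Coupling (d : ℕ) : Type := Option {j : ℕ // j ∈ Finset.Icc 2 d}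

/-- The part of the potential that multiplies a given formal parameter. The one for `none` is what
remains of `tr D² / 4` when the Gaussian term `(N / 2) tr H²` is removed. -/
def interaction (d : ℕ) (τ : GeomType) {N : ℕ} (H : Matrix (Fin N) (Fin N) ℂ) :
    Coupling d → ℝ
  | none => 1 / 4 * diracTr τ H 2 - (N : ℝ) / 2 * matTr H 2
  | some j => 1 / 2 * (1 / (2 * (j.1 : ℝ)) * diracTr τ H (2 * j.1))

/-- The values of the formal parameters that give back the potential `tr S(D) / 2`. -/
def couplingVal (d : ℕ) (t : ℕ → ℝ) : Coupling d → ℝ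
  | none => 1
  | some j => t j.1

/-- The decomposition of `tr S(D) / 2` on which the perturbative expansion is based. -/
theorem potential_eq (d : ℕ) (t : ℕ → ℝ) (τ : GeomType) {N : ℕ}
    (H : Matrix (Fin N) (Fin N) ℂ) :
    potential d t τ H =
      (N : ℝ) / 2 * matTr H 2 + ∑ i, couplingVal d t i * interaction d τ H i := by
  have key : ∀ j : ℕ, ((t j : ℂ) / (2 * j)) = ((t j / (2 * j) : ℝ) : ℂ) := by
    intro j; push_cast; rfl
  have h2 : (1 / 2 : ℂ) = ((1 / 2 : ℝ) : ℂ) := by push_cast; rfl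
  have hsum : ∑ x : {j : ℕ // j ∈ Finset.Icc 2 d},
      t x.1 * (1 / 2 * (1 / (2 * (x.1 : ℝ)) * diracTr τ H (2 * x.1))) =
      ∑ j ∈ Finset.Icc 2 d, t j * (1 / 2 * (1 / (2 * (j : ℝ)) * diracTr τ H (2 * j))) :=
    Finset.sum_coe_sort (Finset.Icc 2 d)
      (fun j => t j * (1 / 2 * (1 / (2 * (j : ℝ)) * diracTr τ H (2 * j))))
  have hre : (LinearMap.trace ℂ (Matrix (Fin N) (Fin N) ℂ) (actionOp d t τ H)).re =
      1 / 2 * diracTr τ H 2 +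
        ∑ j ∈ Finset.Icc 2 d, t j / (2 * j) * diracTr τ H (2 * j) := by
    simp only [actionOp, map_add, map_sum, map_smul, Complex.add_re, Complex.re_sum, smul_eq_mul,
      key, h2, Complex.re_ofReal_mul, diracTr]
  rw [potential, hre, Fintype.sum_option]
  simp only [couplingVal, interaction]
  rw [hsum, mul_add, Finset.mul_sum]
  have : ∑ j ∈ Finset.Icc 2 d, 1 / 2 * (t j / (2 * (j : ℝ)) * diracTr τ H (2 * j)) =
      ∑ j ∈ Finset.Icc 2 d, t j * (1 / 2 * (1 / (2 * (j : ℝ)) * diracTr τ H (2 * j))) :=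
    Finset.sum_congr rfl fun j _ => by ring
  rw [this]
  ring

/-- The formal integral of the observable `f`: the Gaussian expectation of
`f(H) exp (- ∑ i, s i * interaction i)`, expanded as a formal power series in the parameters
`s i`, with Gaussian expectations taken term by term. -/
def formalInt (d : ℕ) (τ : GeomType) (N : ℕ) (f : Matrix (Fin N) (Fin N) ℂ → ℝ) :
    MvPowerSeries (Coupling d) ℝ :=
  fun n => (n.prod fun _ k => (-1 : ℝ) ^ k / (k.factorial : ℝ)) *
    gaussExp N fun H => f H * n.prod fun i k => interaction d τ H i ^ k

/-- The formal expectation `⟨f⟩`, normalised by the formal partition function. -/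
def formalExp (d : ℕ) (τ : GeomType) (N : ℕ) (f : Matrix (Fin N) (Fin N) ℂ → ℝ) :
    MvPowerSeries (Coupling d) ℝ :=
  formalInt d τ N f * (formalInt d τ N fun _ => 1)⁻¹

/-- The formal moments `N⁻¹ ⟨tr H ^ ℓ⟩` of the mean eigenvalue distribution of `H`. -/
def matMoment (d : ℕ) (τ : GeomType) (N ℓ : ℕ) : MvPowerSeries (Coupling d) ℝ :=
  formalExp d τ N fun H => matTr H ℓ / (N : ℝ)

/-- The formal moments `N⁻² ⟨tr D ^ ℓ⟩` of the mean eigenvalue distribution of `D`. -/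
def diracMoment (d : ℕ) (τ : GeomType) (N ℓ : ℕ) : MvPowerSeries (Coupling d) ℝ :=
  formalExp d τ N fun H => diracTr τ H ℓ / (N : ℝ) ^ 2

/-- `m` is the large `N` limit, coefficient by coefficient, of the sequence of formal moments
`E N`. -/
def IsFormalLimit {σ : Type*} (E : ℕ → ℕ → MvPowerSeries σ ℝ) (m : ℕ → MvPowerSeries σ ℝ) :
    Prop :=
  ∀ (ℓ : ℕ) (n : σ →₀ ℕ),
    Tendsto (fun N : ℕ => MvPowerSeries.coeff n (E N ℓ)) atTop
      (𝓝 (MvPowerSeries.coeff n (m ℓ)))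

/-- The probability density `ρ` is a limiting spectral density, at the coupling constants `c` and
in the formal sense, of a model with formal moments `E N ℓ`: these have a large `N` limit, and the
limiting formal moments, summed at `c`, are the moments of `ρ`. -/
structure IsLimitingDensity {σ : Type*} (E : ℕ → ℕ → MvPowerSeries σ ℝ) (c : σ → ℝ)
    (ρ : ℝ → ℝ) : Prop where
  nonneg : ∀ᵐ x : ℝ, 0 ≤ ρ x
  integrable : ∀ ℓ : ℕ, Integrable fun x : ℝ => x ^ ℓ * ρ x
  integral_eq_one : ∫ x : ℝ, ρ x = 1
  moments : ∃ m : ℕ → MvPowerSeries σ ℝ, IsFormalLimit E m ∧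
    ∀ ℓ : ℕ, HasSum (fun n : σ →₀ ℕ => MvPowerSeries.coeff n (m ℓ) * n.prod fun i k => c i ^ k)
      (∫ x : ℝ, x ^ ℓ * ρ x)

/-- The self-convolution `(ρ * ρ)(x) = ∫ ρ(x - u) ρ(u) du`. -/
def selfConv (ρ : ℝ → ℝ) (x : ℝ) : ℝ :=
  ∫ u : ℝ, ρ (x - u) * ρ u

/-- Self-convolution at the level of moments: `∫∫ (x + y) ^ ℓ ρ(x) ρ(y) dx dy` in terms of the
moments `m k = ∫ x ^ k ρ(x) dx`. It makes sense for formal moments. -/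
def momentConv {R : Type*} [CommSemiring R] (m : ℕ → R) (ℓ : ℕ) : R :=
  ∑ k ∈ Finset.range (ℓ + 1), (ℓ.choose k : R) * (m (ℓ - k) * m k)

end DiracEnsemble

end

noncomputable section

/-! ### Loop equations and asymptotic factorisation -/

namespace DiracEnsemble

open MvPolynomial Asymptotics

/-! Let `X a` stand for the normalised trace tr H^a / N. The Dirac operator is left multiplication
by H plus or minus right multiplication by H. These commute, so tr D^ℓ / N² is the binomial sum of
the products `X (ℓ - k) * X k`, with signs (-1)^k in type (0,1) (`diracTr_eq`). The signs do no
harm: the potential is even in H, so the odd moments vanish (`matMoment_of_odd`). What remains is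
asymptotic factorisation: in the limit, the expectation of a product of normalised traces is the
product of the expectations.

Factorisation follows from the loop equations. Gaussian integration by parts along the vector field
H^a, together with the fact that each interaction is N² times a polynomial `V i` in the normalised
traces, gives ⟨X (a+1) P⟩ = ⟨splitPoly a · P⟩ - ∑ s_i ⟨splice a (V i) · P⟩ + N⁻² ⟨splice a P⟩. If `X
b` has weight b + 1, the first and last terms on the right have smaller weight than the left side,
while the factor s_i lowers the exponent at which the coefficient is read. Induction on the
exponent, then on the weight, shows that all coefficients stay bounded (`isBigO_coeff`). The
covariance ⟨PQ⟩ - ⟨P⟩⟨Q⟩ obeys the same recursion up to N⁻² times a bounded term, so it tends to 0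
(`tendsto_coeff_mul_sub`). No genus expansion is needed.

For actual densities, unconditional convergence in ℝ is absolute, so evaluation at the couplings
respects products (`hasSum_coeff_mul`), and the binomial theorem gives the moments of the
self-convolution (`integral_pow_mul_selfConv`). Bounded support makes the moments grow at most
geometrically; the characteristic function is then the sum of its moment series, which yields
uniqueness (`ae_eq_of_moments_eq`). -/

/-- The derivation of the algebra of normalised traces induced by moving in the direction
`H ^ a`. -/
def splice (a : ℕ) : Derivation ℝ (MvPolynomial ℕ ℝ) (MvPolynomial ℕ ℝ) :=
  mkDerivation ℝ fun b => (b : ℝ) • X (a + b - 1)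

/-- The normalised divergence of `H ↦ H ^ a`, in terms of the normalised traces. -/
def splitPoly (a : ℕ) : MvPolynomial ℕ ℝ := ∑ p ∈ Finset.range a, X p * X (a - 1 - p)

theorem splice_X (a b : ℕ) : splice a (X b) = (b : ℝ) • X (a + b - 1) := by
  simp [splice, mkDerivation_X]

/-- `HasWeightLE k P`: every monomial of `P` has weight at most `k`, where `X b` has
weight `b + 1`. -/
inductive HasWeightLE : ℕ → MvPolynomial ℕ ℝ → Prop
  | one : HasWeightLE 0 1
  | X_mul {k : ℕ} {P : MvPolynomial ℕ ℝ} (b : ℕ) :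
      HasWeightLE k P → HasWeightLE (k + b + 1) (X b * P)
  | add {k : ℕ} {P Q : MvPolynomial ℕ ℝ} :
      HasWeightLE k P → HasWeightLE k Q → HasWeightLE k (P + Q)
  | smul {k : ℕ} {P : MvPolynomial ℕ ℝ} (c : ℝ) : HasWeightLE k P → HasWeightLE k (c • P)
  | mono {k l : ℕ} {P : MvPolynomial ℕ ℝ} : HasWeightLE k P → k ≤ l → HasWeightLE l P

namespace HasWeightLE

theorem zero (k : ℕ) : HasWeightLE k 0 := by
  simpa using (HasWeightLE.one.smul 0).mono (Nat.zero_le k)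

theorem sum {ι : Type*} {k : ℕ} {s : Finset ι} {f : ι → MvPolynomial ℕ ℝ}
    (h : ∀ i ∈ s, HasWeightLE k (f i)) : HasWeightLE k (∑ i ∈ s, f i) := by
  classical
  induction s using Finset.induction_on with
  | empty => simpa using zero k
  | insert i s hi ih =>
    rw [Finset.sum_insert hi]
    exact (h i (by simp)).add (ih fun j hj => h j (by simp [hj]))

theorem exists_weight (P : MvPolynomial ℕ ℝ) : ∃ k, HasWeightLE k P := by
  induction P using MvPolynomial.induction_on with
  | C a =>
    refine ⟨0, ?_⟩
    have := HasWeightLE.one.smul a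
    rwa [smul_eq_C_mul, mul_one] at this
  | add P Q hP hQ =>
    obtain ⟨k, hk⟩ := hP
    obtain ⟨l, hl⟩ := hQ
    exact ⟨max k l, (hk.mono (le_max_left _ _)).add (hl.mono (le_max_right _ _))⟩
  | mul_X P b hP =>
    obtain ⟨k, hk⟩ := hP
    rw [mul_comm]
    exact ⟨_, hk.X_mul b⟩

theorem splice {k : ℕ} {P : MvPolynomial ℕ ℝ} (hP : HasWeightLE k P) (a : ℕ) :
    HasWeightLE (k + a) (splice a P) := by
  induction hP with
  | one => simpa using zero _
  | @X_mul k P b hP ih =>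
    rw [Derivation.leibniz, splice_X, smul_eq_mul, smul_eq_mul]
    refine ((ih.X_mul b).mono (by omega)).add ?_
    rw [mul_smul_comm, mul_comm]
    rcases Nat.eq_zero_or_pos b with rfl | hb
    · simpa using zero _
    · exact ((hP.X_mul (a + b - 1)).mono (by omega)).smul _
  | add _ _ h1 h2 => rw [map_add]; exact h1.add h2
  | smul c _ h => rw [Derivation.map_smul]; exact h.smul c
  | mono _ hkl h => exact h.mono (by omega)

theorem splitPoly_mul {k : ℕ} {P : MvPolynomial ℕ ℝ} (hP : HasWeightLE k P) (a : ℕ) :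
    HasWeightLE (k + a + 1) (splitPoly a * P) := by
  rw [splitPoly, Finset.sum_mul]
  refine sum fun p hp => ?_
  rw [Finset.mem_range] at hp
  rw [mul_assoc]
  exact ((hP.X_mul (a - 1 - p)).X_mul p).mono (by omega)

/-- Induction principle for linear statements about polynomials in the normalised traces. -/
theorem linear_induction {motive : MvPolynomial ℕ ℝ → Prop} (one : motive 1)
    (X_mul : ∀ k b P, HasWeightLE k P →
      (∀ Q, HasWeightLE (k + b) Q → motive Q) → motive (X b * P))
    (add : ∀ P Q, motive P → motive Q → motive (P + Q))
    (smul : ∀ (c : ℝ) P, motive P → motive (c • P)) (P : MvPolynomial ℕ ℝ) : motive P := by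
  -- The outer induction is on a strict bound for the weight. The inner one takes apart the
  -- derivation of `HasWeightLE`, so that sums and scalar multiples are handled at fixed weight.
  have key : ∀ K k P, HasWeightLE k P → k < K → motive P := by
    intro K
    induction K with
    | zero => intro k P _ h; omega
    | succ K ih =>
      intro k P hP
      induction hP with
      | one => exact fun _ => one
      | @X_mul k P b hP _ =>
        exact fun h => X_mul k b P hP fun Q hQ => ih _ Q hQ (by omega)
      | add _ _ h1 h2 => exact fun h => add _ _ (h1 h) (h2 h)
      | smul c _ h1 => exact fun h => smul c _ (h1 h)
      | mono _ hkl h1 => exact fun h => h1 (by omega)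
  obtain ⟨k, hk⟩ := exists_weight P
  exact key (k + 1) k P hk (by omega)

end HasWeightLE

theorem coeff_X_mul' {σ : Type*} (n : σ →₀ ℕ) (i : σ) (f : MvPowerSeries σ ℝ) :
    MvPowerSeries.coeff n (MvPowerSeries.X i * f) =
      if n i = 0 then 0 else MvPowerSeries.coeff (n - Finsupp.single i 1) f := by
  classical
  rw [MvPowerSeries.X_def, MvPowerSeries.coeff_monomial_mul]
  by_cases h : n i = 0
  · rw [if_pos h, if_neg]
    intro hle
    have := hle i
    simp at this
    omega
  · rw [if_neg h, if_pos, one_mul]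
    intro j
    by_cases hj : i = j
    · subst hj; simp; omega
    · simp [hj]

theorem sub_single_lt {σ : Type*} {n : σ →₀ ℕ} {i : σ} (h : n i ≠ 0) :
    n - Finsupp.single i 1 < n := by
  refine lt_of_le_of_ne tsub_le_self fun h' => ?_
  have := DFunLike.congr_fun h' i
  simp at this
  omega

/-- A sequence of linear functionals on the algebra of normalised traces, with values in formal
power series, which solve the loop equations of the model with potential `N² ∑ i, s i V i`. -/
structure SolvesLoopEquations {σ : Type*} [Fintype σ]
    (Φ : ℕ → MvPolynomial ℕ ℝ →ₗ[ℝ] MvPowerSeries σ ℝ) (V : σ → MvPolynomial ℕ ℝ) : Prop where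
  one : ∀ᶠ N in atTop, Φ N 1 = 1
  X_zero_mul : ∀ᶠ N in atTop, ∀ P, Φ N (X 0 * P) = Φ N P
  X_succ_mul : ∀ᶠ N : ℕ in atTop, ∀ a P, Φ N (X (a + 1) * P) =
    Φ N (splitPoly a * P) - ∑ i, MvPowerSeries.X i * Φ N (splice a (V i) * P) +
      ((N : ℝ) ^ 2)⁻¹ • Φ N (splice a P)

namespace SolvesLoopEquations

variable {σ : Type*} [Fintype σ] {Φ : ℕ → MvPolynomial ℕ ℝ →ₗ[ℝ] MvPowerSeries σ ℝ}
  {V : σ → MvPolynomial ℕ ℝ}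

theorem tendsto_inv_sq : Tendsto (fun N : ℕ => ((N : ℝ) ^ 2)⁻¹) atTop (𝓝 0) :=
  tendsto_inv_atTop_zero.comp
    ((tendsto_pow_atTop two_ne_zero).comp tendsto_natCast_atTop_atTop)

/-- The loop equation expresses each coefficient through coefficients that are earlier in the double
induction, with factors bounded in N. -/
theorem isBigO_coeff (h : SolvesLoopEquations Φ V) (n : σ →₀ ℕ) (P : MvPolynomial ℕ ℝ) :
    (fun N => MvPowerSeries.coeff n (Φ N P)) =O[atTop] fun _ => (1 : ℝ) := by
  induction n using WellFoundedLT.induction generalizing P with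
  | _ n ihn =>
  induction P using HasWeightLE.linear_induction with
  | one =>
    refine (isBigO_refl (fun _ : ℕ => MvPowerSeries.coeff n (1 : MvPowerSeries σ ℝ))
      atTop).congr' ?_ .rfl |>.trans (isBigO_const_const _ one_ne_zero _)
    filter_upwards [h.one] with N hN
    rw [hN]
  | add P Q hP hQ => simpa only [map_add] using hP.add hQ
  | smul c P hP => simpa only [map_smul, smul_eq_mul] using hP.const_mul_left c
  | X_mul k b P hP ih =>
    -- `X 0` has weight 1 rather than 0, so deleting it already lowers the weight.
    rcases b with _ | a
    · refine (ih P hP).congr' ?_ .rfl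
      filter_upwards [h.X_zero_mul] with N hN
      rw [hN]
    · have e1 := ih _ (hP.splitPoly_mul a)
      have e2 : (fun N => ∑ i, MvPowerSeries.coeff n
          (MvPowerSeries.X i * Φ N (splice a (V i) * P))) =O[atTop] fun _ => (1 : ℝ) := by
        refine IsBigO.fun_sum (E' := ℝ) fun i _ => ?_
        simp only [coeff_X_mul']
        split_ifs with hi
        · exact isBigO_zero _ _
        · exact ihn _ (sub_single_lt hi) _
      have e3 := (tendsto_inv_sq.isBigO_one ℝ).mul (ih _ ((hP.splice a).mono (by omega)))
      simp only [mul_one] at e3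
      refine ((e1.sub e2).add e3).congr' ?_ .rfl
      filter_upwards [h.X_succ_mul] with N hN
      simp [hN, map_sum]

theorem isBigO_coeff_mul (h : SolvesLoopEquations Φ V) (n : σ →₀ ℕ) (P Q : MvPolynomial ℕ ℝ) :
    (fun N => MvPowerSeries.coeff n (Φ N P * Φ N Q)) =O[atTop] fun _ => (1 : ℝ) := by
  classical
  simp only [MvPowerSeries.coeff_mul]
  refine IsBigO.fun_sum (E' := ℝ) fun i _ => ?_
  simpa using (h.isBigO_coeff i.1 P).mul (h.isBigO_coeff i.2 Q)

/-- Solutions of the loop equations are asymptotically multiplicative. -/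
theorem tendsto_coeff_mul_sub (h : SolvesLoopEquations Φ V) (n : σ →₀ ℕ)
    (P Q : MvPolynomial ℕ ℝ) :
    Tendsto (fun N => MvPowerSeries.coeff n (Φ N (P * Q) - Φ N P * Φ N Q)) atTop (𝓝 0) := by
  induction n using WellFoundedLT.induction generalizing P with
  | _ n ihn =>
  induction P using HasWeightLE.linear_induction with
  | one =>
    refine tendsto_const_nhds.congr' ?_
    filter_upwards [h.one] with N hN
    simp [hN]
  | add P R hP hR =>
    simpa only [add_mul, map_add, map_sub, add_sub_add_comm, add_zero] using hP.add hR
  | smul c P hP =>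
    simpa only [smul_mul_assoc, map_smul, ← smul_sub, smul_eq_mul, mul_zero]
      using hP.const_mul c
  | X_mul k b P hP ih =>
    rcases b with _ | a
    · refine (ih P hP).congr' ?_
      filter_upwards [h.X_zero_mul] with N hN
      rw [mul_assoc, hN, hN]
    · have e1 := ih _ (hP.splitPoly_mul a)
      have e2 : Tendsto (fun N => ∑ i, MvPowerSeries.coeff n (MvPowerSeries.X i *
          (Φ N (splice a (V i) * P * Q) - Φ N (splice a (V i) * P) * Φ N Q)))
          atTop (𝓝 (∑ _i : σ, 0)) := by
        refine tendsto_finsetSum _ fun i _ => ?_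
        simp only [coeff_X_mul']
        split_ifs with hi
        · exact tendsto_const_nhds
        · exact ihn _ (sub_single_lt hi) _
      -- Here `splice a` also hits Q, so this is not a covariance of lower weight. Boundedness is
      -- enough, because of the factor N⁻².
      have e3 : Tendsto (fun N : ℕ => ((N : ℝ) ^ 2)⁻¹ * MvPowerSeries.coeff n
          (Φ N (splice a (P * Q)) - Φ N (splice a P) * Φ N Q)) atTop (𝓝 0) := by
        have hb : (fun N => MvPowerSeries.coeff n
            (Φ N (splice a (P * Q)) - Φ N (splice a P) * Φ N Q)) =O[atTop]
            fun _ => (1 : ℝ) := by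
          simpa only [map_sub] using (h.isBigO_coeff n _).sub (h.isBigO_coeff_mul n _ _)
        have := ((isLittleO_one_iff ℝ).2 tendsto_inv_sq).mul_isBigO hb
        simpa only [mul_one, isLittleO_one_iff] using this
      have e := (e1.sub e2).add e3
      simp only [Finset.sum_const_zero, sub_zero, add_zero] at e
      refine e.congr' ?_
      filter_upwards [h.X_succ_mul] with N hN
      rw [mul_assoc (X (a + 1)), hN, hN, ← MvPowerSeries.coeff_smul, ← map_sum, ← map_sub, ← map_add]
      congr 1
      simp only [mul_sub, Finset.sum_sub_distrib, add_mul, sub_mul, Finset.sum_mul, smul_sub,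
        smul_mul_assoc, mul_assoc]
      abel

/-- A coefficient of a product of series is a finite sum, so factorisation carries the
coefficientwise limits over to products. -/
theorem tendsto_coeff_mul (h : SolvesLoopEquations Φ V) {P Q : MvPolynomial ℕ ℝ}
    {f g : MvPowerSeries σ ℝ}
    (hf : ∀ n, Tendsto (fun N => MvPowerSeries.coeff n (Φ N P)) atTop
      (𝓝 (MvPowerSeries.coeff n f)))
    (hg : ∀ n, Tendsto (fun N => MvPowerSeries.coeff n (Φ N Q)) atTop
      (𝓝 (MvPowerSeries.coeff n g))) (n : σ →₀ ℕ) :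
    Tendsto (fun N => MvPowerSeries.coeff n (Φ N (P * Q))) atTop
      (𝓝 (MvPowerSeries.coeff n (f * g))) := by
  classical
  have : Tendsto (fun N => MvPowerSeries.coeff n (Φ N P * Φ N Q)) atTop
      (𝓝 (MvPowerSeries.coeff n (f * g))) := by
    simp only [MvPowerSeries.coeff_mul]
    exact tendsto_finsetSum _ fun i _ => (hf i.1).mul (hg i.2)
  simpa using (h.tendsto_coeff_mul_sub n P Q).add this

end SolvesLoopEquations

end DiracEnsemble

/-! ### Gaussian integration by parts on Hermitian matrices -/

namespace DiracEnsemble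

variable {N : ℕ}

theorem herm_isHermitian (x : Fin N → Fin N → ℝ) : (herm x).IsHermitian :=
  (herm_bijOn N).mapsTo (Set.mem_univ x)

/-- `herm` as a linear map. -/
def hermLin (N : ℕ) : (Fin N → Fin N → ℝ) →ₗ[ℝ] Matrix (Fin N) (Fin N) ℂ where
  toFun := herm
  map_add' x y := by
    ext i j
    simp only [herm, Matrix.of_apply, Matrix.add_apply, Pi.add_apply]
    split_ifs <;> simp [Complex.ext_iff, add_comm]
  map_smul' c x := by
    ext i j
    simp only [herm, Matrix.of_apply, Matrix.smul_apply, Pi.smul_apply, RingHom.id_apply]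
    split_ifs <;> simp [Complex.ext_iff]

theorem herm_add_smul (x v : Fin N → Fin N → ℝ) (t : ℝ) :
    herm (x + t • v) = herm x + (t : ℂ) • herm v := by
  have h1 := (hermLin N).map_add x (t • v)
  rw [LinearMap.map_smul] at h1
  refine h1.trans ?_
  ext i j
  simp [hermLin]

theorem herm_neg (x : Fin N → Fin N → ℝ) : herm (-x) = -herm x := (hermLin N).map_neg x

/-- An entry of `herm` as a continuous linear functional. -/
def hermEntry (i j : Fin N) : (Fin N → Fin N → ℝ) →L[ℝ] ℂ :=
  LinearMap.toContinuousLinearMap (Matrix.entryLinearMap ℝ ℂ i j ∘ₗ hermLin N)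

theorem hermEntry_apply (i j : Fin N) (x : Fin N → Fin N → ℝ) :
    hermEntry i j x = herm x i j := rfl

theorem ofReal_matTr {H : Matrix (Fin N) (Fin N) ℂ} (hH : H.IsHermitian) (ℓ : ℕ) :
    ((matTr H ℓ : ℝ) : ℂ) = Matrix.trace (H ^ ℓ) := by
  rw [matTr]
  refine Complex.conj_eq_iff_re.1 ?_
  have := Matrix.trace_conjTranspose (H ^ ℓ)
  rw [(hH.pow ℓ).eq] at this
  exact this.symm

/-- The density of the Gaussian model. -/
def gaussWeight (N : ℕ) (x : Fin N → Fin N → ℝ) : ℝ :=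
  Real.exp (-((N : ℝ) / 2 * matTr (herm x) 2))

/-- tr H² is the sum of all |H_ij|², in which each off-diagonal coordinate is counted twice. -/
theorem sum_sq_le_matTr (x : Fin N → Fin N → ℝ) : ∑ i, ∑ j, x i j ^ 2 ≤ matTr (herm x) 2 := by
  have h : matTr (herm x) 2 = ∑ i, ∑ j, Complex.normSq (herm x i j) := by
    rw [matTr, sq, Matrix.trace, Complex.re_sum]
    refine Finset.sum_congr rfl fun i _ => ?_
    rw [Matrix.diag_apply, Matrix.mul_apply, Complex.re_sum]
    refine Finset.sum_congr rfl fun j _ => ?_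
    rw [← (herm_isHermitian x).apply j i, RCLike.star_def, Complex.mul_conj, Complex.ofReal_re]
  rw [h]
  refine Finset.sum_le_sum fun i _ => Finset.sum_le_sum fun j _ => ?_
  rcases lt_trichotomy i j with h | h | h
  · simp [herm, h, Complex.normSq_apply]; nlinarith [sq_nonneg (x j i)]
  · subst h; simp [herm, Complex.normSq_apply, sq]
  · simp [herm, h, h.not_gt, Complex.normSq_apply]; nlinarith [sq_nonneg (x j i)]

theorem norm_sq_le_sum_sq (x : Fin N → Fin N → ℝ) : ‖x‖ ^ 2 ≤ ∑ i, ∑ j, x i j ^ 2 := by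
  have h0 : ∀ i, 0 ≤ ∑ j, x i j ^ 2 := fun i => Finset.sum_nonneg fun j _ => sq_nonneg _
  have h1 : ‖x‖ ≤ √(∑ i, ∑ j, x i j ^ 2) := by
    refine (pi_norm_le_iff_of_nonneg (Real.sqrt_nonneg _)).2 fun i =>
      (pi_norm_le_iff_of_nonneg (Real.sqrt_nonneg _)).2 fun j => Real.le_sqrt_of_sq_le ?_
    rw [Real.norm_eq_abs, sq_abs]
    exact (Finset.single_le_sum (f := fun j => x i j ^ 2) (fun j _ => sq_nonneg _)
      (Finset.mem_univ j)).trans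
      (Finset.single_le_sum (f := fun i => ∑ j, x i j ^ 2) (fun i _ => h0 i) (Finset.mem_univ i))
  calc ‖x‖ ^ 2 ≤ √(∑ i, ∑ j, x i j ^ 2) ^ 2 := by gcongr
    _ = _ := Real.sq_sqrt (Finset.sum_nonneg fun i _ => h0 i)

theorem one_add_pow_le_exp {b : ℝ} (hb : 0 < b) (k : ℕ) :
    ∃ K : ℝ, 0 ≤ K ∧ ∀ r : ℝ, 0 ≤ r → (1 + r) ^ k ≤ K * Real.exp (b * r ^ 2) := by
  refine ⟨k.factorial * Real.exp (1 + 1 / (4 * b)), by positivity, fun r hr => ?_⟩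
  have h1 := Real.pow_div_factorial_le_exp (1 + r) (by positivity) k
  rw [div_le_iff₀ (by positivity)] at h1
  have h2 : r ≤ b * r ^ 2 + 1 / (4 * b) := by
    have : b * r ^ 2 + 1 / (4 * b) - r = (2 * b * r - 1) ^ 2 / (4 * b) := by
      field_simp; ring
    have h3 : 0 ≤ (2 * b * r - 1) ^ 2 / (4 * b) := by positivity
    linarith
  calc (1 + r) ^ k ≤ Real.exp (1 + r) * k.factorial := h1
    _ ≤ Real.exp (1 + 1 / (4 * b) + b * r ^ 2) * k.factorial := by
        exact mul_le_mul_of_nonneg_right (Real.exp_le_exp.2 (by linarith)) (by positivity)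
    _ = _ := by rw [Real.exp_add]; ring

theorem integrable_exp_neg_sum_sq {b : ℝ} (hb : 0 < b) :
    Integrable fun x : Fin N → Fin N → ℝ => Real.exp (-b * ∑ i, ∑ j, x i j ^ 2) := by
  have h : ∀ x : Fin N → Fin N → ℝ, Real.exp (-b * ∑ i, ∑ j, x i j ^ 2) =
      ∏ i, ∏ j, Real.exp (-b * x i j ^ 2) := by
    intro x
    simp only [Finset.mul_sum, Real.exp_sum]
  simp only [h]
  exact Integrable.fintype_prod (f := fun _ (y : Fin N → ℝ) => ∏ j, Real.exp (-b * y j ^ 2))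
    fun _ => Integrable.fintype_prod (f := fun _ (y : ℝ) => Real.exp (-b * y ^ 2))
      fun _ => integrable_exp_neg_mul_sq hb

/-- Continuous functions of polynomial growth. -/
structure PolyGrowth {E : Type*} [NormedAddCommGroup E] (f : E → ℂ) : Prop where
  continuous : Continuous f
  bound : ∃ (C : ℝ) (k : ℕ), ∀ x, ‖f x‖ ≤ C * (1 + ‖x‖) ^ k

namespace PolyGrowth

variable {E : Type*} [NormedAddCommGroup E] {f g : E → ℂ}

theorem const (c : ℂ) : PolyGrowth fun _ : E => c :=
  ⟨continuous_const, ‖c‖, 0, fun x => by simp⟩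

theorem add (hf : PolyGrowth f) (hg : PolyGrowth g) : PolyGrowth fun x => f x + g x := by
  refine ⟨hf.continuous.add hg.continuous, ?_⟩
  obtain ⟨C, k, h⟩ := hf.bound
  obtain ⟨D, l, h'⟩ := hg.bound
  refine ⟨|C| + |D|, max k l, fun x => (norm_add_le _ _).trans ?_⟩
  have h1 : (1 : ℝ) ≤ 1 + ‖x‖ := by linarith [norm_nonneg x]
  rw [add_mul]
  refine add_le_add ((h x).trans ?_) ((h' x).trans ?_)
  · exact mul_le_mul (le_abs_self _) (pow_le_pow_right₀ h1 (le_max_left _ _)) (by positivity)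
      (abs_nonneg _)
  · exact mul_le_mul (le_abs_self _) (pow_le_pow_right₀ h1 (le_max_right _ _)) (by positivity)
      (abs_nonneg _)

theorem mul (hf : PolyGrowth f) (hg : PolyGrowth g) : PolyGrowth fun x => f x * g x := by
  refine ⟨hf.continuous.mul hg.continuous, ?_⟩
  obtain ⟨C, k, h⟩ := hf.bound
  obtain ⟨D, l, h'⟩ := hg.bound
  refine ⟨C * D, k + l, fun x => ?_⟩
  rw [norm_mul, pow_add, mul_mul_mul_comm]
  exact mul_le_mul (h x) (h' x) (norm_nonneg _) ((norm_nonneg _).trans (h x))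

theorem sum {ι : Type*} {s : Finset ι} {f : ι → E → ℂ} (h : ∀ i ∈ s, PolyGrowth (f i)) :
    PolyGrowth fun x => ∑ i ∈ s, f i x := by
  classical
  induction s using Finset.induction_on with
  | empty => simpa using const 0
  | insert i s hi ih =>
    simp only [Finset.sum_insert hi]
    exact (h i (by simp)).add (ih fun j hj => h j (by simp [hj]))

theorem clm [NormedSpace ℝ E] (L : E →L[ℝ] ℂ) : PolyGrowth fun x => L x := by
  refine ⟨L.continuous, ‖L‖, 1, fun x => (L.le_opNorm x).trans ?_⟩
  rw [pow_one]
  gcongr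
  linarith

theorem integrable_mul_gaussWeight {f : (Fin N → Fin N → ℝ) → ℂ} (hN : 0 < N)
    (hf : PolyGrowth f) : Integrable fun x => f x * (gaussWeight N x : ℂ) := by
  obtain ⟨C, k, h⟩ := hf.bound
  have hN' : (0 : ℝ) < N := Nat.cast_pos.2 hN
  -- The weight is at most exp(-(N/2) ∑ x²). Half of this exponent pays for the polynomial growth;
  -- the other half remains integrable.
  obtain ⟨K, hK, hK'⟩ := one_add_pow_le_exp (b := (N : ℝ) / 4) (by positivity) k
  have hcont : Continuous fun x : Fin N → Fin N → ℝ => gaussWeight N x := by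
    unfold gaussWeight matTr
    have : ∀ x : Fin N → Fin N → ℝ, (Matrix.trace (herm x ^ 2)).re =
        (∑ i, ∑ j, hermEntry i j x * hermEntry j i x).re := by
      intro x
      simp [sq, Matrix.trace, Matrix.mul_apply, hermEntry_apply]
    simp only [this]
    fun_prop
  refine ((integrable_exp_neg_sum_sq (N := N) (b := (N : ℝ) / 4)
    (by positivity)).const_mul (|C| * K)).mono'
    (hf.continuous.mul (Complex.continuous_ofReal.comp hcont)).aestronglyMeasurable
    (Eventually.of_forall fun x => ?_)
  rw [norm_mul, Complex.norm_real, Real.norm_eq_abs, gaussWeight, abs_of_pos (Real.exp_pos _)]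
  have h1 := sum_sq_le_matTr x
  have h2 := norm_sq_le_sum_sq x
  calc ‖f x‖ * Real.exp (-((N : ℝ) / 2 * matTr (herm x) 2))
      ≤ (|C| * (K * Real.exp ((N : ℝ) / 4 * ‖x‖ ^ 2))) *
          Real.exp (-((N : ℝ) / 2 * matTr (herm x) 2)) := by
        gcongr
        refine (h x).trans ?_
        exact mul_le_mul (le_abs_self _) (hK' _ (norm_nonneg _)) (by positivity) (abs_nonneg _)
    _ = |C| * K * Real.exp ((N : ℝ) / 4 * ‖x‖ ^ 2 + -((N : ℝ) / 2 * matTr (herm x) 2)) := by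
        rw [Real.exp_add]; ring
    _ ≤ _ := by
        gcongr
        nlinarith

end PolyGrowth

theorem integrable_gaussWeight (hN : 0 < N) : Integrable (gaussWeight N) := by
  have := ((PolyGrowth.const (E := Fin N → Fin N → ℝ) 1).integrable_mul_gaussWeight hN).re
  simpa using this

theorem integral_gaussWeight_pos (hN : 0 < N) : 0 < ∫ x, gaussWeight N x :=
  integral_exp_pos (integrable_gaussWeight hN)

theorem hasLineDerivAt_gaussWeight (x v : Fin N → Fin N → ℝ) :
    HasLineDerivAt ℝ (fun x => (gaussWeight N x : ℂ))
      (-(N * Matrix.trace (herm x * herm v)) * gaussWeight N x) x v := by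
  have h : ∀ x : Fin N → Fin N → ℝ, (gaussWeight N x : ℂ) =
      Complex.exp (-((N : ℂ) / 2 * Matrix.trace (herm x ^ 2))) := by
    intro x
    rw [gaussWeight, ← ofReal_matTr (herm_isHermitian x)]
    push_cast
    rfl
  have h2 : ∀ t : ℝ, Matrix.trace (herm (x + t • v) ^ 2) = Matrix.trace (herm x ^ 2) +
      t * (2 * Matrix.trace (herm x * herm v)) + (t : ℂ) ^ 2 * Matrix.trace (herm v ^ 2) := by
    intro t
    rw [herm_add_smul]
    simp only [sq, add_mul, mul_add, Matrix.trace_add, Matrix.smul_mul, Matrix.mul_smul,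
      Matrix.trace_smul, smul_eq_mul, Matrix.trace_mul_comm (herm v) (herm x)]
    ring
  unfold HasLineDerivAt
  simp only [h, h2]
  have hd : HasDerivAt (fun t : ℝ => (t : ℂ)) 1 0 := Complex.ofRealCLM.hasDerivAt
  have := ((((hd.mul_const (2 * Matrix.trace (herm x * herm v))).const_add
    (Matrix.trace (herm x ^ 2))).add ((hd.pow 2).mul_const
      (Matrix.trace (herm v ^ 2)))).const_mul ((N : ℂ) / 2)).neg.cexp
  refine this.congr_deriv ?_
  simp
  ring

/-- `HasHolDeriv f f'`: the function `f` of a Hermitian matrix is of polynomial growth and has the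
directional derivatives `f'`, which extend complex linearly to all directions. -/
structure HasHolDeriv (f : (Fin N → Fin N → ℝ) → ℂ)
    (f' : (Fin N → Fin N → ℝ) → Matrix (Fin N) (Fin N) ℂ →ₗ[ℂ] ℂ) : Prop where
  growth : PolyGrowth f
  growth' : ∀ A, PolyGrowth fun x => f' x A
  hasLineDerivAt : ∀ x v, HasLineDerivAt ℝ f (f' x (herm v)) x v

namespace HasHolDeriv

variable {f g : (Fin N → Fin N → ℝ) → ℂ}
  {f' g' : (Fin N → Fin N → ℝ) → Matrix (Fin N) (Fin N) ℂ →ₗ[ℂ] ℂ}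

theorem const (c : ℂ) : HasHolDeriv (N := N) (fun _ => c) 0 :=
  ⟨.const c, fun _ => by simpa using PolyGrowth.const 0, fun x v => by
    simpa using! hasDerivAt_const (0 : ℝ) c⟩

theorem add (hf : HasHolDeriv f f') (hg : HasHolDeriv g g') :
    HasHolDeriv (fun x => f x + g x) fun x => f' x + g' x :=
  ⟨hf.growth.add hg.growth, fun A => (hf.growth' A).add (hg.growth' A), fun x v => by
    have := HasDerivAt.fun_add (hf.hasLineDerivAt x v) (hg.hasLineDerivAt x v)
    exact this⟩

theorem mul (hf : HasHolDeriv f f') (hg : HasHolDeriv g g') :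
    HasHolDeriv (fun x => f x * g x) fun x => g x • f' x + f x • g' x :=
  ⟨hf.growth.mul hg.growth, fun A =>
    (hg.growth.mul (hf.growth' A)).add (hf.growth.mul (hg.growth' A)), fun x v => by
    have := HasDerivAt.fun_mul (hf.hasLineDerivAt x v) (hg.hasLineDerivAt x v)
    refine HasDerivAt.congr_deriv this ?_
    simp
    ring⟩

theorem sum {ι : Type*} {s : Finset ι} {f : ι → (Fin N → Fin N → ℝ) → ℂ}
    {f' : ι → (Fin N → Fin N → ℝ) → Matrix (Fin N) (Fin N) ℂ →ₗ[ℂ] ℂ}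
    (h : ∀ i ∈ s, HasHolDeriv (f i) (f' i)) :
    HasHolDeriv (fun x => ∑ i ∈ s, f i x) fun x => ∑ i ∈ s, f' i x := by
  classical
  induction s using Finset.induction_on with
  | empty => simpa using! const 0
  | insert i s hi ih =>
    simp only [Finset.sum_insert hi]
    exact (h i (by simp)).add (ih fun j hj => h j (by simp [hj]))

theorem entry (i j : Fin N) : HasHolDeriv (N := N) (fun x => herm x i j)
    fun _ => Matrix.entryLinearMap ℂ ℂ i j :=
  ⟨.clm (hermEntry i j), fun A => .const _, fun x v => by
    have := (hermEntry i j).hasFDerivAt.hasLineDerivAt (x := x) v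
    exact this⟩

/-- Gaussian integration by parts in a Hermitian direction. -/
theorem integral_trace_mul_herm (hN : 0 < N) (hf : HasHolDeriv f f') (v : Fin N → Fin N → ℝ) :
    N * ∫ x, Matrix.trace (herm x * herm v) * f x * gaussWeight N x =
      ∫ x, f' x (herm v) * gaussWeight N x := by
  have hg : PolyGrowth fun x : Fin N → Fin N → ℝ => Matrix.trace (herm x * herm v) := by
    simp only [Matrix.trace, Matrix.diag_apply, Matrix.mul_apply]
    exact .sum fun i _ => .sum fun j _ => (PolyGrowth.clm (hermEntry i j)).mul (.const _)
  have key := integral_bilinear_hasLineDerivAt_right_eq_neg_left_of_integrable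
    (μ := (volume : Measure (Fin N → Fin N → ℝ))) (B := ContinuousLinearMap.mul ℝ ℂ)
    (f := f) (f' := fun x => f' x (herm v)) (g := fun x => (gaussWeight N x : ℂ))
    (g' := fun x => -(N * Matrix.trace (herm x * herm v)) * gaussWeight N x) (v := v)
    ((hf.growth' _).integrable_mul_gaussWeight hN)
    (by
      have := (((hf.growth.mul hg).mul (.const (-(N : ℂ)))).integrable_mul_gaussWeight hN)
      refine this.congr (Eventually.of_forall fun x => ?_)
      simp only [ContinuousLinearMap.mul_apply']
      ring)
    (hf.growth.integrable_mul_gaussWeight hN)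
    (fun x _ => hf.hasLineDerivAt x v) (fun x _ => hasLineDerivAt_gaussWeight x v)
  simp only [ContinuousLinearMap.mul_apply'] at key
  rw [eq_neg_iff_add_eq_zero] at key
  rw [← sub_eq_zero, ← neg_eq_zero, ← key, ← integral_const_mul, neg_sub, sub_eq_add_neg,
    ← integral_neg, add_comm]
  congr 2
  funext x
  ring

/-- Gaussian integration by parts in a complex direction. -/
theorem integral_trace_mul (hN : 0 < N) (hf : HasHolDeriv f f')
    (A : Matrix (Fin N) (Fin N) ℂ) :
    N * ∫ x, Matrix.trace (herm x * A) * f x * gaussWeight N x =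
      ∫ x, f' x A * gaussWeight N x := by
  have hg : ∀ B : Matrix (Fin N) (Fin N) ℂ,
      PolyGrowth fun x : Fin N → Fin N → ℝ => Matrix.trace (herm x * B) := by
    intro B
    simp only [Matrix.trace, Matrix.diag_apply, Matrix.mul_apply]
    exact .sum fun i _ => .sum fun j _ => (PolyGrowth.clm (hermEntry i j)).mul (.const _)
  -- Both sides are complex linear in the direction, and every matrix is a Hermitian one plus i
  -- times another. This makes the matrix units available as directions.
  obtain ⟨v, w, rfl⟩ : ∃ v w : Fin N → Fin N → ℝ, A = herm v + Complex.I • herm w := by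
    obtain ⟨v, -, hv⟩ := (herm_bijOn N).surjOn (realPart A).2
    obtain ⟨w, -, hw⟩ := (herm_bijOn N).surjOn (imaginaryPart A).2
    exact ⟨v, w, by rw [hv, hw, realPart_add_I_smul_imaginaryPart]⟩
  have e1 := hf.integral_trace_mul_herm hN v
  have e2 := hf.integral_trace_mul_herm hN w
  have i1 := ((hg (herm v)).mul hf.growth).integrable_mul_gaussWeight hN
  have i2 := ((hg (herm w)).mul hf.growth).integrable_mul_gaussWeight hN
  have j1 := (hf.growth' (herm v)).integrable_mul_gaussWeight hN
  have j2 := (hf.growth' (herm w)).integrable_mul_gaussWeight hN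
  have l : ∀ x, Matrix.trace (herm x * (herm v + Complex.I • herm w)) * f x * gaussWeight N x =
      Matrix.trace (herm x * herm v) * f x * gaussWeight N x +
        Complex.I * (Matrix.trace (herm x * herm w) * f x * gaussWeight N x) := by
    intro x
    rw [mul_add, Matrix.trace_add, Matrix.mul_smul, Matrix.trace_smul, smul_eq_mul]
    ring
  have r : ∀ x, f' x (herm v + Complex.I • herm w) * gaussWeight N x =
      f' x (herm v) * gaussWeight N x + Complex.I * (f' x (herm w) * gaussWeight N x) := by
    intro x
    rw [map_add, map_smul, smul_eq_mul]
    ring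
  simp only [l, r]
  rw [integral_add i1 (i2.const_mul _), integral_add j1 (j2.const_mul _), integral_const_mul,
    integral_const_mul, ← e1, ← e2]
  ring

end HasHolDeriv

end DiracEnsemble

/-! ### Loop equations of the Gaussian model -/

namespace DiracEnsemble

open MvPolynomial

variable {N : ℕ}

/-- The derivative of `M ↦ M ^ p`. -/
def powDeriv (p : ℕ) (M : Matrix (Fin N) (Fin N) ℂ) :
    Matrix (Fin N) (Fin N) ℂ →ₗ[ℂ] Matrix (Fin N) (Fin N) ℂ :=
  ∑ r ∈ Finset.range p, LinearMap.mulLeft ℂ (M ^ r) ∘ₗ LinearMap.mulRight ℂ (M ^ (p - 1 - r))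

theorem powDeriv_apply (p : ℕ) (M A : Matrix (Fin N) (Fin N) ℂ) :
    powDeriv p M A = ∑ r ∈ Finset.range p, M ^ r * (A * M ^ (p - 1 - r)) := by
  simp [powDeriv, LinearMap.sum_apply]

theorem powDeriv_succ (p : ℕ) (M A : Matrix (Fin N) (Fin N) ℂ) :
    powDeriv (p + 1) M A = powDeriv p M A * M + M ^ p * A := by
  rw [powDeriv_apply, powDeriv_apply, Finset.sum_range_succ, Finset.sum_mul]
  congr 1
  · refine Finset.sum_congr rfl fun r hr => ?_
    rw [Finset.mem_range] at hr
    rw [show p + 1 - 1 - r = p - 1 - r + 1 by omega, pow_succ]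
    simp only [mul_assoc]
  · simp

theorem trace_powDeriv_pow (p a : ℕ) (M : Matrix (Fin N) (Fin N) ℂ) :
    Matrix.trace (powDeriv p M (M ^ a)) = p * Matrix.trace (M ^ (a + p - 1)) := by
  rw [powDeriv_apply, Matrix.trace_sum, Finset.sum_congr rfl
    (g := fun _ => Matrix.trace (M ^ (a + p - 1)))]
  · simp
  · intro r hr
    rw [Finset.mem_range] at hr
    rw [← pow_add, ← pow_add]
    congr 2
    omega

/-- For a matrix unit, (A E_ij B)_ij = A_ii B_jj. Summing over i and j splits one trace into two,
which is the origin of `splitPoly`. -/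
theorem sum_powDeriv_single (p : ℕ) (M : Matrix (Fin N) (Fin N) ℂ) :
    ∑ i, ∑ j, powDeriv p M (Matrix.single i j 1) i j =
      ∑ r ∈ Finset.range p, Matrix.trace (M ^ r) * Matrix.trace (M ^ (p - 1 - r)) := by
  have h : ∀ r i j, (M ^ r * (Matrix.single i j (1 : ℂ) * M ^ (p - 1 - r))) i j =
      (M ^ r) i i * (M ^ (p - 1 - r)) j j := by
    intro r i j
    rw [Matrix.mul_apply, Finset.sum_eq_single i]
    · simp
    · intro k _ hk
      rw [Matrix.single_mul_apply_of_ne _ _ _ _ _ hk, mul_zero]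
    · simp
  simp only [powDeriv_apply, Matrix.sum_apply, h]
  rw [Finset.sum_congr rfl fun i _ => Finset.sum_comm, Finset.sum_comm]
  refine Finset.sum_congr rfl fun r _ => ?_
  simp only [Matrix.trace, Matrix.diag_apply, Finset.sum_mul_sum]

theorem HasHolDeriv.pow_entry (p : ℕ) (i j : Fin N) :
    HasHolDeriv (fun x => (herm x ^ p) i j)
      fun x => Matrix.entryLinearMap ℂ ℂ i j ∘ₗ powDeriv p (herm x) := by
  induction p generalizing i j with
  | zero =>
    convert HasHolDeriv.const (N := N) ((1 : Matrix (Fin N) (Fin N) ℂ) i j) using 2 with x x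
    · rw [pow_zero]
    · exact LinearMap.ext fun A => by simp [powDeriv]
  | succ p ih =>
    have h := HasHolDeriv.sum (s := Finset.univ) fun k _ => (ih i k).mul (.entry k j)
    convert h using 2 with x x
    · rw [pow_succ, Matrix.mul_apply]
    · refine LinearMap.ext fun A => ?_
      simp [LinearMap.sum_apply, powDeriv_succ, Matrix.mul_apply, Finset.sum_add_distrib,
        mul_comm]

/-- The value at `H` of a polynomial in the normalised traces `tr H ^ a / N`. -/
def evalTr (P : MvPolynomial ℕ ℝ) (H : Matrix (Fin N) (Fin N) ℂ) : ℝ :=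
  eval (fun a => matTr H a / N) P

theorem ofReal_evalTr_X (x : Fin N → Fin N → ℝ) (a : ℕ) :
    ((evalTr (X a) (herm x) : ℝ) : ℂ) = Matrix.trace (herm x ^ a) / N := by
  rw [evalTr, eval_X, Complex.ofReal_div, ofReal_matTr (herm_isHermitian x)]
  simp

theorem evalTr_mul (P Q : MvPolynomial ℕ ℝ) (H : Matrix (Fin N) (Fin N) ℂ) :
    evalTr (P * Q) H = evalTr P H * evalTr Q H := by
  simp [evalTr]

theorem evalTr_add (P Q : MvPolynomial ℕ ℝ) (H : Matrix (Fin N) (Fin N) ℂ) :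
    evalTr (P + Q) H = evalTr P H + evalTr Q H := by
  simp [evalTr]

theorem evalTr_smul (c : ℝ) (P : MvPolynomial ℕ ℝ) (H : Matrix (Fin N) (Fin N) ℂ) :
    evalTr (c • P) H = c * evalTr P H := by
  simp [evalTr]

/-- Moving H along H^a changes tr H^b at rate b tr H^(a+b-1), and the Leibniz rule extends this to
polynomials. The derivative is left existential: its linearity and its values on powers of H are all
that is used. -/
theorem exists_hasHolDeriv_evalTr (P : MvPolynomial ℕ ℝ) :
    ∃ f' : (Fin N → Fin N → ℝ) → Matrix (Fin N) (Fin N) ℂ →ₗ[ℂ] ℂ,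
      HasHolDeriv (fun x => ((evalTr P (herm x) : ℝ) : ℂ)) f' ∧
      ∀ x a, f' x (herm x ^ a) = ((evalTr (splice a P) (herm x) : ℝ) : ℂ) := by
  have hX : ∀ b : ℕ, ∃ f' : (Fin N → Fin N → ℝ) → Matrix (Fin N) (Fin N) ℂ →ₗ[ℂ] ℂ,
      HasHolDeriv (fun x => ((evalTr (X b) (herm x) : ℝ) : ℂ)) f' ∧
      ∀ x a, f' x (herm x ^ a) = ((evalTr (splice a (X b)) (herm x) : ℝ) : ℂ) := by
    intro b
    have h := (HasHolDeriv.const (N := N) ((N : ℂ)⁻¹)).mul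
      (.sum (s := Finset.univ) fun i _ => HasHolDeriv.pow_entry b i i)
    have he : (fun x : Fin N → Fin N → ℝ => ((evalTr (X b) (herm x) : ℝ) : ℂ)) =
        fun x => (N : ℂ)⁻¹ * ∑ i, (herm x ^ b) i i := by
      funext x
      rw [ofReal_evalTr_X, Matrix.trace, div_eq_inv_mul]
      rfl
    rw [he]
    refine ⟨_, h, fun x a => ?_⟩
    have := trace_powDeriv_pow b a (herm x)
    simp only [Matrix.trace, Matrix.diag_apply] at this
    simp [splice_X, evalTr_smul, ofReal_evalTr_X, LinearMap.sum_apply, this, Matrix.trace]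
    ring
  induction P using MvPolynomial.induction_on with
  | C c =>
    refine ⟨0, ?_, fun x a => ?_⟩
    · simpa [evalTr] using HasHolDeriv.const (N := N) (c : ℂ)
    · have : splice a (C c) = 0 := Derivation.map_algebraMap _ c
      simp [this, evalTr]
  | add P Q hP hQ =>
    obtain ⟨f', hf, hf'⟩ := hP
    obtain ⟨g', hg, hg'⟩ := hQ
    refine ⟨_, by simpa [evalTr_add] using hf.add hg, fun x a => ?_⟩
    simp [hf', hg', evalTr_add]
  | mul_X P b hP =>
    obtain ⟨f', hf, hf'⟩ := hP
    obtain ⟨g', hg, hg'⟩ := hX b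
    refine ⟨_, by simpa [evalTr_mul] using hf.mul hg, fun x a => ?_⟩
    simp [hf', hg', evalTr_add, evalTr_mul]
    ring

theorem integrable_evalTr_mul (hN : 0 < N) (P : MvPolynomial ℕ ℝ) :
    Integrable fun x : Fin N → Fin N → ℝ => evalTr P (herm x) * gaussWeight N x := by
  obtain ⟨f', hf, -⟩ := exists_hasHolDeriv_evalTr (N := N) P
  simpa using (hf.growth.integrable_mul_gaussWeight hN).re

/-- The loop equations of the Gaussian model. -/
theorem integral_evalTr_X_succ_mul (hN : 0 < N) (a : ℕ) (P : MvPolynomial ℕ ℝ) :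
    ∫ x : Fin N → Fin N → ℝ, evalTr (X (a + 1) * P) (herm x) * gaussWeight N x =
      (∫ x : Fin N → Fin N → ℝ, evalTr (splitPoly a * P) (herm x) * gaussWeight N x) +
      ((N : ℝ) ^ 2)⁻¹ *
        ∫ x : Fin N → Fin N → ℝ, evalTr (splice a P) (herm x) * gaussWeight N x := by
  obtain ⟨f', hf, hf'⟩ := exists_hasHolDeriv_evalTr (N := N) P
  have hN' : (N : ℂ) ≠ 0 := Nat.cast_ne_zero.2 hN.ne'
  have hd := fun i j => (HasHolDeriv.pow_entry a i j).mul hf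
  -- Integrating (H^a)_ij P by parts along E_ij and summing gives the divergence of the vector field
  -- P H^a.
  have key : ∑ i : Fin N, ∑ j, ((N : ℂ) * ∫ x, Matrix.trace (herm x * Matrix.single i j 1) *
      ((herm x ^ a) i j * (evalTr P (herm x) : ℝ)) * gaussWeight N x) = _ :=
    Finset.sum_congr rfl fun i _ => Finset.sum_congr rfl fun j _ =>
      (hd i j).integral_trace_mul hN (Matrix.single i j 1)
  have hint : ∀ i j : Fin N, Integrable fun x : Fin N → Fin N → ℝ =>
      Matrix.trace (herm x * Matrix.single i j 1) *
      ((herm x ^ a) i j * (evalTr P (herm x) : ℝ)) * (gaussWeight N x : ℂ) := by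
    intro i j
    have := ((HasHolDeriv.entry (N := N) j i).mul (hd i j)).growth.integrable_mul_gaussWeight hN
    refine this.congr (Eventually.of_forall fun x => ?_)
    simp [Matrix.trace_mul_comm (herm x), Matrix.trace_single_mul]
  simp only [← Finset.mul_sum] at key
  rw [Finset.sum_congr rfl fun i _ => (integral_finsetSum _ fun j _ => hint i j).symm,
    ← integral_finsetSum _ fun i _ => integrable_finsetSum _ fun j _ => hint i j,
    Finset.sum_congr rfl fun i _ => (integral_finsetSum _ fun j _ =>
      ((hd i j).growth' (Matrix.single i j 1)).integrable_mul_gaussWeight hN).symm,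
    ← integral_finsetSum _ fun i _ => integrable_finsetSum _ fun j _ =>
      ((hd i j).growth' (Matrix.single i j 1)).integrable_mul_gaussWeight hN] at key
  have hl : ∀ x : Fin N → Fin N → ℝ, ∑ i, ∑ j, Matrix.trace (herm x * Matrix.single i j 1) *
      ((herm x ^ a) i j * (evalTr P (herm x) : ℝ)) * (gaussWeight N x : ℂ) =
      N * ((evalTr (X (a + 1) * P) (herm x) * gaussWeight N x : ℝ) : ℂ) := by
    intro x
    rw [evalTr_mul]
    push_cast
    rw [ofReal_evalTr_X, pow_succ, Matrix.trace]
    simp only [Matrix.diag_apply, Matrix.mul_apply, Matrix.trace_mul_comm (herm x),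
      Matrix.trace_single_mul, Finset.sum_mul, Finset.sum_div, Finset.mul_sum]
    refine Finset.sum_congr rfl fun i _ => Finset.sum_congr rfl fun j _ => ?_
    field_simp
    rw [one_smul]
    ring
  have hr : ∀ x : Fin N → Fin N → ℝ, ∑ i, ∑ j,
      ((((evalTr P (herm x) : ℝ) : ℂ) • (Matrix.entryLinearMap ℂ ℂ i j ∘ₗ powDeriv a (herm x)) +
        (herm x ^ a) i j • f' x) (Matrix.single i j 1)) * (gaussWeight N x : ℂ) =
      N ^ 2 * ((evalTr (splitPoly a * P) (herm x) * gaussWeight N x : ℝ) : ℂ) +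
        ((evalTr (splice a P) (herm x) * gaussWeight N x : ℝ) : ℂ) := by
    intro x
    have h1 := sum_powDeriv_single a (herm x)
    have h2 : ∑ i, ∑ j, (herm x ^ a) i j * f' x (Matrix.single i j 1) =
        ((evalTr (splice a P) (herm x) : ℝ) : ℂ) := by
      rw [← hf']
      conv_rhs => rw [Matrix.matrix_eq_sum_single (herm x ^ a)]
      simp only [map_sum]
      refine Finset.sum_congr rfl fun i _ => Finset.sum_congr rfl fun j _ => ?_
      rw [← smul_eq_mul, ← map_smul, Matrix.smul_single, smul_eq_mul, mul_one]
    have h3 : ((evalTr (splitPoly a) (herm x) : ℝ) : ℂ) =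
        (∑ r ∈ Finset.range a, Matrix.trace (herm x ^ r) * Matrix.trace (herm x ^ (a - 1 - r))) /
          N ^ 2 := by
      have : evalTr (splitPoly a) (herm x) = ∑ r ∈ Finset.range a,
          evalTr (X r) (herm x) * evalTr (X (a - 1 - r)) (herm x) := by
        simp [evalTr, splitPoly]
      rw [this, Complex.ofReal_sum, Finset.sum_div]
      refine Finset.sum_congr rfl fun r _ => ?_
      rw [Complex.ofReal_mul, ofReal_evalTr_X, ofReal_evalTr_X]
      field_simp
    rw [evalTr_mul]
    push_cast
    rw [h3, ← h1, ← h2]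
    simp only [← Finset.sum_mul, LinearMap.add_apply, LinearMap.smul_apply, smul_eq_mul,
      Finset.sum_add_distrib, ← Finset.mul_sum, LinearMap.comp_apply,
      Matrix.entryLinearMap_apply]
    field_simp
  simp only [hl, hr] at key
  have i : ∀ Q, Integrable fun x : Fin N → Fin N → ℝ =>
      ((evalTr Q (herm x) * gaussWeight N x : ℝ) : ℂ) :=
    fun Q => (integrable_evalTr_mul hN Q).ofReal
  rw [integral_add ((i _).const_mul _) (i _), integral_const_mul, integral_const_mul,
    integral_complex_ofReal, integral_complex_ofReal, integral_complex_ofReal] at key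
  have hN'' : (N : ℝ) ≠ 0 := Nat.cast_ne_zero.2 hN.ne'
  have key' : (N : ℝ) * (N * ∫ x : Fin N → Fin N → ℝ,
      evalTr (X (a + 1) * P) (herm x) * gaussWeight N x) =
      (N : ℝ) ^ 2 * (∫ x : Fin N → Fin N → ℝ,
        evalTr (splitPoly a * P) (herm x) * gaussWeight N x) +
      ∫ x : Fin N → Fin N → ℝ, evalTr (splice a P) (herm x) * gaussWeight N x := by
    exact_mod_cast key
  field_simp
  linarith

end DiracEnsemble

/-! ### Traces of the Dirac operator -/

namespace DiracEnsemble

open MvPolynomial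

variable {N : ℕ}

theorem trace_mulLeft_mul_mulRight (A B : Matrix (Fin N) (Fin N) ℂ) :
    LinearMap.trace ℂ (Matrix (Fin N) (Fin N) ℂ)
      (LinearMap.mulLeft ℂ A * LinearMap.mulRight ℂ B) = Matrix.trace A * Matrix.trace B := by
  rw [LinearMap.trace_eq_matrix_trace ℂ (Matrix.stdBasis ℂ (Fin N) (Fin N)), Matrix.trace,
    Fintype.sum_prod_type]
  simp only [Matrix.diag_apply, LinearMap.toMatrix_apply, Matrix.stdBasis_eq_single,
    Module.End.mul_apply, LinearMap.mulLeft_apply, LinearMap.mulRight_apply, Matrix.trace,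
    Finset.sum_mul_sum]
  refine Finset.sum_congr rfl fun i _ => Finset.sum_congr rfl fun j _ => ?_
  have : ∀ M : Matrix (Fin N) (Fin N) ℂ,
      (Matrix.stdBasis ℂ (Fin N) (Fin N)).repr M (i, j) = M i j := by
    intro M
    simp [Matrix.stdBasis]
  rw [this, Matrix.mul_apply, Finset.sum_eq_single i]
  · simp
  · intro k _ hk
    rw [Matrix.single_mul_apply_of_ne _ _ _ _ _ hk, mul_zero]
  · simp

/-- The sign of the right multiplication in the Dirac operator. -/
def GeomType.sign : GeomType → ℝ
  | .oneZero => 1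
  | .zeroOne => -1

theorem diracOp_eq (τ : GeomType) (H : Matrix (Fin N) (Fin N) ℂ) :
    diracOp τ H = (τ.sign : ℂ) • LinearMap.mulRight ℂ H + LinearMap.mulLeft ℂ H := by
  cases τ
  · simp [diracOp, GeomType.sign, add_comm]
  · refine LinearMap.ext fun M => ?_
    simp [diracOp, GeomType.sign, smul_sub, smul_smul]
    abel

/-- Commuting left and right multiplications allow the binomial theorem, and the trace of each mixed
product factors by `trace_mulLeft_mul_mulRight`. -/
theorem diracTr_eq (τ : GeomType) {H : Matrix (Fin N) (Fin N) ℂ} (hH : H.IsHermitian) (ℓ : ℕ) :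
    diracTr τ H ℓ = ∑ k ∈ Finset.range (ℓ + 1),
      (ℓ.choose k : ℝ) * τ.sign ^ k * (matTr H (ℓ - k) * matTr H k) := by
  have hc : Commute ((τ.sign : ℂ) • LinearMap.mulRight ℂ H) (LinearMap.mulLeft ℂ H) :=
    (LinearMap.commute_mulLeft_right H H).symm.smul_left _
  have : LinearMap.trace ℂ (Matrix (Fin N) (Fin N) ℂ) (diracOp τ H ^ ℓ) =
      ((∑ k ∈ Finset.range (ℓ + 1),
        (ℓ.choose k : ℝ) * τ.sign ^ k * (matTr H (ℓ - k) * matTr H k) : ℝ) : ℂ) := by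
    rw [diracOp_eq, hc.add_pow, map_sum, Complex.ofReal_sum]
    refine Finset.sum_congr rfl fun k _ => ?_
    push_cast
    rw [(hc.pow_pow _ _).eq, smul_pow, LinearMap.pow_mulLeft, LinearMap.pow_mulRight,
      mul_smul_comm, smul_mul_assoc, map_smul, ← nsmul_eq_mul', map_nsmul,
      trace_mulLeft_mul_mulRight, ofReal_matTr hH, ofReal_matTr hH]
    simp only [smul_eq_mul, nsmul_eq_mul]
    ring
  rw [diracTr, this, Complex.ofReal_re]

theorem matTr_eq (H : Matrix (Fin N) (Fin N) ℂ) (a : ℕ) :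
    matTr H a = N * evalTr (X a) H := by
  rw [evalTr, eval_X]
  rcases Nat.eq_zero_or_pos N with rfl | hN
  · simp [matTr, Matrix.trace]
  · have : (N : ℝ) ≠ 0 := Nat.cast_ne_zero.2 hN.ne'
    field_simp

/-- The normalised trace `N⁻² tr D ^ ℓ` as a polynomial in the normalised traces of `H`. -/
def diracPoly (τ : GeomType) (ℓ : ℕ) : MvPolynomial ℕ ℝ :=
  ∑ k ∈ Finset.range (ℓ + 1), ((ℓ.choose k : ℝ) * τ.sign ^ k) • (X (ℓ - k) * X k)

theorem diracTr_eq_evalTr (τ : GeomType) {H : Matrix (Fin N) (Fin N) ℂ} (hH : H.IsHermitian)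
    (ℓ : ℕ) : diracTr τ H ℓ = (N : ℝ) ^ 2 * evalTr (diracPoly τ ℓ) H := by
  have : evalTr (diracPoly τ ℓ) H = ∑ k ∈ Finset.range (ℓ + 1),
      (ℓ.choose k : ℝ) * τ.sign ^ k * (evalTr (X (ℓ - k)) H * evalTr (X k) H) := by
    simp [evalTr, diracPoly]
  rw [diracTr_eq τ hH, this, Finset.mul_sum]
  refine Finset.sum_congr rfl fun k _ => ?_
  rw [matTr_eq, matTr_eq]
  ring

/-- The interaction, divided by `N²`, as a polynomial in the normalised traces of `H`. -/
def interactionPoly (d : ℕ) (τ : GeomType) : Coupling d → MvPolynomial ℕ ℝ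
  | none => (1 / 4 : ℝ) • diracPoly τ 2 - (1 / 2 : ℝ) • X 2
  | some j => (1 / 2 * (1 / (2 * (j.1 : ℝ)))) • diracPoly τ (2 * j.1)

theorem interaction_eq (d : ℕ) (τ : GeomType) {H : Matrix (Fin N) (Fin N) ℂ}
    (hH : H.IsHermitian) (i : Coupling d) :
    interaction d τ H i = (N : ℝ) ^ 2 * evalTr (interactionPoly d τ i) H := by
  cases i with
  | none =>
    have : evalTr (interactionPoly d τ none) H =
        1 / 4 * evalTr (diracPoly τ 2) H - 1 / 2 * evalTr (X 2) H := by
      simp [interactionPoly, evalTr]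
    rw [interaction, this, diracTr_eq_evalTr τ hH, matTr_eq]
    ring
  | some j =>
    rw [interaction, interactionPoly, evalTr_smul, diracTr_eq_evalTr τ hH]
    ring

/-! ### Loop equations of the formal model -/

theorem gaussExp_congr {f g : Matrix (Fin N) (Fin N) ℂ → ℝ}
    (h : ∀ H : Matrix (Fin N) (Fin N) ℂ, H.IsHermitian → f H = g H) :
    gaussExp N f = gaussExp N g := by
  simp only [gaussExp, fun x => h (herm x) (herm_isHermitian x)]

/-- The Gaussian expectation on polynomials in the normalised traces. -/
def gaussLin (N : ℕ) : MvPolynomial ℕ ℝ →ₗ[ℝ] ℝ where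
  toFun P := gaussExp N fun H => evalTr P H
  map_add' P Q := by
    have h : ∀ P, Integrable fun x : Fin N → Fin N → ℝ => evalTr P (herm x) * gaussWeight N x := by
      intro P
      rcases Nat.eq_zero_or_pos N with rfl | hN
      · exact Integrable.of_finite
      · exact integrable_evalTr_mul hN P
    simp only [gaussExp, evalTr_add, add_mul, ← add_div]
    congr 1
    exact integral_add (h P) (h Q)
  map_smul' c P := by
    simp only [gaussExp, evalTr_smul, mul_assoc, integral_const_mul, RingHom.id_apply,
      smul_eq_mul, mul_div_assoc]

theorem gaussLin_apply (P : MvPolynomial ℕ ℝ) :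
    gaussLin N P = gaussExp N fun H => evalTr P H := rfl

theorem gaussLin_one (hN : 0 < N) : gaussLin N 1 = 1 := by
  have h : (∫ x, gaussWeight N x) ≠ 0 := (integral_gaussWeight_pos hN).ne'
  have : ∀ H : Matrix (Fin N) (Fin N) ℂ, evalTr 1 H = 1 := fun H => by simp [evalTr]
  simp only [gaussLin_apply, gaussExp, this, one_mul]
  exact div_self h

theorem gaussLin_X_zero_mul (hN : 0 < N) (P : MvPolynomial ℕ ℝ) :
    gaussLin N (X 0 * P) = gaussLin N P := by
  refine gaussExp_congr fun H _ => ?_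
  have : (N : ℝ) ≠ 0 := Nat.cast_ne_zero.2 hN.ne'
  rw [evalTr_mul, show evalTr (X 0) H = 1 by simp [evalTr, matTr, this], one_mul]

theorem gaussLin_X_succ_mul (hN : 0 < N) (a : ℕ) (P : MvPolynomial ℕ ℝ) :
    gaussLin N (X (a + 1) * P) =
      gaussLin N (splitPoly a * P) + ((N : ℝ) ^ 2)⁻¹ * gaussLin N (splice a P) := by
  simp only [gaussLin_apply, gaussExp]
  rw [mul_div_assoc', ← add_div]
  congr 1
  exact integral_evalTr_X_succ_mul hN a P

theorem prod_eq_mul_prod_erase {ι M : Type*} [Fintype ι] [DecidableEq ι] [CommMonoid M]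
    (g : ι → ℕ → M) (n : ι → ℕ) (i : ι) :
    ∏ j, g j (n j) = g i (n i) * ∏ j ∈ Finset.univ.erase i, g j (n j) :=
  (Finset.mul_prod_erase _ _ (Finset.mem_univ i)).symm

/-- The truncated subtraction is harmless: when `n i = 0`, the prefactor kills the term. -/
theorem derivation_prod_pow {ι A : Type*} [Fintype ι] [DecidableEq ι] [CommRing A] [Algebra ℝ A]
    (D : Derivation ℝ A A) (W : ι → A) (n : ι →₀ ℕ) :
    D (∏ j, W j ^ n j) =
      ∑ i, (n i : ℝ) • (D (W i) * ∏ j, W j ^ (n - Finsupp.single i 1 : ι →₀ ℕ) j) := by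
  have h : ∀ s : Finset ι, D (∏ j ∈ s, W j ^ n j) =
      ∑ i ∈ s, (∏ j ∈ s.erase i, W j ^ n j) * D (W i ^ n i) := by
    intro s
    induction s using Finset.induction_on with
    | empty => simp
    | insert a s ha ih =>
      rw [Finset.prod_insert ha, Derivation.leibniz, ih, Finset.sum_insert ha,
        Finset.erase_insert ha, smul_eq_mul, smul_eq_mul, add_comm, Finset.mul_sum]
      congr 1
      refine Finset.sum_congr rfl fun i hi => ?_
      have hai : a ≠ i := fun h => ha (h ▸ hi)
      rw [Finset.erase_insert_of_ne hai, Finset.prod_insert (by simp [ha]), mul_assoc]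
  rw [h]
  refine Finset.sum_congr rfl fun i _ => ?_
  rw [prod_eq_mul_prod_erase (fun j k => W j ^ k) (n - Finsupp.single i 1 : ι →₀ ℕ) i,
    Derivation.leibniz_pow]
  have he : ∏ j ∈ Finset.univ.erase i, W j ^ (n - Finsupp.single i 1 : ι →₀ ℕ) j =
      ∏ j ∈ Finset.univ.erase i, W j ^ n j := by
    refine Finset.prod_congr rfl fun j hj => ?_
    have : i ≠ j := fun h => (Finset.ne_of_mem_erase hj) h.symm
    simp [this]
  rw [he]
  simp only [Finsupp.coe_tsub, Pi.sub_apply, Finsupp.single_eq_same, smul_eq_mul, nsmul_eq_mul]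
  rw [Algebra.smul_def, map_natCast]
  ring

/-- The coefficient of `exp (- ∑ i, s i)`. -/
def expCoeff {σ : Type*} (n : σ →₀ ℕ) : ℝ := n.prod fun _ k => (-1 : ℝ) ^ k / (k.factorial : ℝ)

/-- The coefficient form of ∂ exp(-s) / ∂s = -exp(-s). -/
theorem natCast_mul_expCoeff {σ : Type*} [Fintype σ] {n : σ →₀ ℕ} {i : σ} (h : n i ≠ 0) :
    n i * expCoeff n = -expCoeff (n - Finsupp.single i 1) := by
  classical
  rw [expCoeff, expCoeff, Finsupp.prod_fintype _ _ (by simp), Finsupp.prod_fintype _ _ (by simp),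
    prod_eq_mul_prod_erase (fun _ k => (-1 : ℝ) ^ k / (k.factorial : ℝ)) n i,
    prod_eq_mul_prod_erase (fun _ k => (-1 : ℝ) ^ k / (k.factorial : ℝ))
      (n - Finsupp.single i 1 : σ →₀ ℕ) i]
  have he : ∏ j ∈ Finset.univ.erase i, (-1 : ℝ) ^ (n - Finsupp.single i 1 : σ →₀ ℕ) j /
      (((n - Finsupp.single i 1 : σ →₀ ℕ) j).factorial : ℝ) =
      ∏ j ∈ Finset.univ.erase i, (-1 : ℝ) ^ n j / ((n j).factorial : ℝ) := by
    refine Finset.prod_congr rfl fun j hj => ?_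
    have : i ≠ j := fun h => (Finset.ne_of_mem_erase hj) h.symm
    simp [this]
  obtain ⟨k, hk⟩ := Nat.exists_eq_succ_of_ne_zero h
  rw [he]
  simp only [Finsupp.coe_tsub, Pi.sub_apply, Finsupp.single_eq_same, hk, Nat.succ_eq_add_one,
    Nat.add_sub_cancel, Nat.factorial_succ, pow_succ]
  push_cast
  field_simp

/-- The monomial of exponent `n` in the interactions. -/
def interactionMonomial (d : ℕ) (τ : GeomType) (N : ℕ) (n : Coupling d →₀ ℕ) :
    MvPolynomial ℕ ℝ :=
  ∏ i, ((N : ℝ) ^ 2 • interactionPoly d τ i) ^ n i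

theorem splice_interactionMonomial (d : ℕ) (τ : GeomType) (N a : ℕ) (n : Coupling d →₀ ℕ) :
    splice a (interactionMonomial d τ N n) = ∑ i, ((n i : ℝ) * (N : ℝ) ^ 2) •
      (splice a (interactionPoly d τ i) *
        interactionMonomial d τ N (n - Finsupp.single i 1)) := by
  classical
  rw [interactionMonomial, derivation_prod_pow]
  refine Finset.sum_congr rfl fun i _ => ?_
  rw [Derivation.map_smul, smul_mul_assoc, smul_smul]
  rfl

/-- The unnormalised formal expectation on polynomials in the normalised traces. -/
def formalIntLin (d : ℕ) (τ : GeomType) (N : ℕ) :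
    MvPolynomial ℕ ℝ →ₗ[ℝ] MvPowerSeries (Coupling d) ℝ where
  toFun P := fun n => expCoeff n * gaussLin N (P * interactionMonomial d τ N n)
  map_add' P Q := by
    funext n
    simp only [add_mul, map_add, mul_add]
    rfl
  map_smul' c P := by
    funext n
    simp only [smul_mul_assoc, map_smul, smul_eq_mul, mul_left_comm _ c]
    rfl

theorem coeff_formalIntLin (d : ℕ) (τ : GeomType) (n : Coupling d →₀ ℕ) (P : MvPolynomial ℕ ℝ) :
    MvPowerSeries.coeff n (formalIntLin d τ N P) =
      expCoeff n * gaussLin N (P * interactionMonomial d τ N n) := rfl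

theorem formalInt_eq {d : ℕ} {τ : GeomType} {f : Matrix (Fin N) (Fin N) ℂ → ℝ}
    {P : MvPolynomial ℕ ℝ}
    (h : ∀ H : Matrix (Fin N) (Fin N) ℂ, H.IsHermitian → f H = evalTr P H) :
    formalInt d τ N f = formalIntLin d τ N P := by
  funext n
  change expCoeff n * gaussExp N _ = expCoeff n * gaussExp N _
  congr 1
  refine gaussExp_congr fun H hH => ?_
  rw [evalTr_mul, h H hH, Finsupp.prod_fintype _ _ (by simp)]
  congr 1
  simp [interactionMonomial, interaction_eq d τ hH, evalTr]

/-- In the Gaussian loop equation, `splice` also differentiates the interaction monomial. Its factor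
N² cancels N⁻², and `natCast_mul_expCoeff` turns the lowered exponent into multiplication by -s_i.
-/
theorem formalIntLin_X_succ_mul (hN : 0 < N) (d : ℕ) (τ : GeomType) (a : ℕ)
    (P : MvPolynomial ℕ ℝ) :
    formalIntLin d τ N (X (a + 1) * P) = formalIntLin d τ N (splitPoly a * P) -
      ∑ i, MvPowerSeries.X i * formalIntLin d τ N (splice a (interactionPoly d τ i) * P) +
      ((N : ℝ) ^ 2)⁻¹ • formalIntLin d τ N (splice a P) := by
  classical
  have hN' : (N : ℝ) ≠ 0 := Nat.cast_ne_zero.2 hN.ne'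
  ext n
  have hX : ∀ i, MvPowerSeries.coeff n (MvPowerSeries.X i *
      formalIntLin d τ N (splice a (interactionPoly d τ i) * P)) =
      -(expCoeff n * (n i * gaussLin N (P * (splice a (interactionPoly d τ i) *
        interactionMonomial d τ N (n - Finsupp.single i 1))))) := by
    intro i
    rw [coeff_X_mul']
    split_ifs with h
    · simp [h]
    · rw [coeff_formalIntLin, ← neg_eq_iff_eq_neg.2 (natCast_mul_expCoeff h)]
      rw [mul_comm _ P, mul_assoc P]
      ring
  rw [map_add, map_sub, map_sum, MvPowerSeries.coeff_smul]
  simp only [hX]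
  simp only [coeff_formalIntLin]
  rw [mul_assoc, gaussLin_X_succ_mul hN, Derivation.leibniz,
    splice_interactionMonomial]
  simp only [smul_eq_mul, map_add, Finset.mul_sum, map_sum, mul_smul_comm, map_smul,
    Finset.sum_neg_distrib]
  rw [mul_assoc, mul_comm (interactionMonomial d τ N n) (splice a P), sub_neg_eq_add, mul_add,
    mul_add, mul_add, Finset.mul_sum, Finset.mul_sum, add_assoc]
  congr 1
  congr 1
  · refine Finset.sum_congr rfl fun i _ => ?_
    field_simp
  · ring

/-- The formal expectation on polynomials in the normalised traces. -/
def formalExpLin (d : ℕ) (τ : GeomType) (N : ℕ) :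
    MvPolynomial ℕ ℝ →ₗ[ℝ] MvPowerSeries (Coupling d) ℝ :=
  LinearMap.mulRight ℝ (formalIntLin d τ N 1)⁻¹ ∘ₗ formalIntLin d τ N

theorem formalExpLin_apply (d : ℕ) (τ : GeomType) (P : MvPolynomial ℕ ℝ) :
    formalExpLin d τ N P = formalIntLin d τ N P * (formalIntLin d τ N 1)⁻¹ := rfl

theorem formalExp_eq {d : ℕ} {τ : GeomType} {f : Matrix (Fin N) (Fin N) ℂ → ℝ}
    {P : MvPolynomial ℕ ℝ}
    (h : ∀ H : Matrix (Fin N) (Fin N) ℂ, H.IsHermitian → f H = evalTr P H) :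
    formalExp d τ N f = formalExpLin d τ N P := by
  rw [formalExp, formalInt_eq h, formalInt_eq (P := 1) fun H _ => by simp [evalTr],
    formalExpLin_apply]

theorem formalExpLin_solvesLoopEquations (d : ℕ) (τ : GeomType) :
    SolvesLoopEquations (formalExpLin d τ) (interactionPoly d τ) where
  one := by
    filter_upwards [eventually_gt_atTop 0] with N hN
    -- The formal partition function has constant term 1, the Gaussian expectation of 1.
    refine MvPowerSeries.mul_inv_cancel _ ?_
    rw [← MvPowerSeries.coeff_zero_eq_constantCoeff_apply, coeff_formalIntLin]
    simp [expCoeff, interactionMonomial, gaussLin_one hN]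
  X_zero_mul := by
    filter_upwards [eventually_gt_atTop 0] with N hN P
    rw [formalExpLin_apply, formalExpLin_apply]
    congr 1
    ext n
    rw [coeff_formalIntLin, coeff_formalIntLin, mul_assoc, gaussLin_X_zero_mul hN]
  X_succ_mul := by
    filter_upwards [eventually_gt_atTop 0] with N hN a P
    simp only [formalExpLin_apply]
    rw [formalIntLin_X_succ_mul hN, add_mul, sub_mul, Finset.sum_mul, smul_mul_assoc]
    simp only [mul_assoc]

theorem matMoment_eq (d : ℕ) (τ : GeomType) (N ℓ : ℕ) :
    matMoment d τ N ℓ = formalExpLin d τ N (X ℓ) :=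
  formalExp_eq fun H _ => by rw [evalTr, eval_X]

theorem diracMoment_eq (d : ℕ) (τ : GeomType) (hN : 0 < N) (ℓ : ℕ) :
    diracMoment d τ N ℓ = formalExpLin d τ N (diracPoly τ ℓ) :=
  formalExp_eq fun H hH => by
    have : (N : ℝ) ≠ 0 := Nat.cast_ne_zero.2 hN.ne'
    rw [diracTr_eq_evalTr τ hH]
    field_simp

/-! ### Parity and the limiting moments of D -/

theorem diracOp_neg (τ : GeomType) (H : Matrix (Fin N) (Fin N) ℂ) :
    diracOp τ (-H) = -diracOp τ H := by
  rw [diracOp_eq, diracOp_eq]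
  refine LinearMap.ext fun M => ?_
  simp
  abel

theorem interaction_neg (d : ℕ) (τ : GeomType) (H : Matrix (Fin N) (Fin N) ℂ) (i : Coupling d) :
    interaction d τ (-H) i = interaction d τ H i := by
  have h : ∀ j, diracTr τ (-H) (2 * j) = diracTr τ H (2 * j) := fun j => by
    rw [diracTr, diracTr, diracOp_neg]
    exact congrArg (fun D => (LinearMap.trace ℂ _ D).re)
      ((even_two_mul j).neg_pow (diracOp τ H))
  cases i with
  | none =>
    have := h 1
    rw [mul_one] at this
    rw [interaction, interaction, this, matTr, matTr, even_two.neg_pow]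
  | some j => rw [interaction, interaction, h]

theorem gaussExp_of_odd {f : Matrix (Fin N) (Fin N) ℂ → ℝ} (h : ∀ H, f (-H) = -f H) :
    gaussExp N f = 0 := by
  have h2 : ∀ x : Fin N → Fin N → ℝ, matTr (-herm x) 2 = matTr (herm x) 2 := fun x => by
    rw [matTr, matTr, even_two.neg_pow]
  have := integral_neg_eq_self (fun x : Fin N → Fin N → ℝ =>
    f (herm x) * Real.exp (-((N : ℝ) / 2 * matTr (herm x) 2))) volume
  simp only [herm_neg, h, h2, neg_mul, integral_neg] at this
  rw [gaussExp, div_eq_zero_iff]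
  left
  linarith

theorem matMoment_of_odd (d : ℕ) (τ : GeomType) (N : ℕ) {ℓ : ℕ} (hℓ : Odd ℓ) :
    matMoment d τ N ℓ = 0 := by
  have : formalInt d τ N (fun H => matTr H ℓ / (N : ℝ)) = 0 := by
    funext n
    rw [formalInt, gaussExp_of_odd, mul_zero]
    · rfl
    · intro H
      simp only [interaction_neg, matTr, hℓ.neg_pow, Matrix.trace_neg, Complex.neg_re]
      ring
  rw [matMoment, formalExp, this, zero_mul]

/-- The formal limiting distribution of the Dirac operator is the self-convolution of that
of `H`. -/
theorem isFormalLimit_diracMoment {d : ℕ} {τ : GeomType}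
    {m : ℕ → MvPowerSeries (Coupling d) ℝ} (hm : IsFormalLimit (matMoment d τ) m) :
    IsFormalLimit (diracMoment d τ) (momentConv m) := by
  have hodd : ∀ k, Odd k → m k = 0 := by
    intro k hk
    ext n
    refine tendsto_nhds_unique (hm k n) ?_
    simpa only [matMoment_of_odd d τ _ hk, map_zero] using tendsto_const_nhds
  -- The commutator signs differ from 1 only for odd k, where the moment is zero. Hence both types
  -- give the same convolution.
  have hsign : ∀ k, τ.sign ^ k • m k = m k := by
    intro k
    rcases Nat.even_or_odd k with hk | hk
    · cases τ <;> simp [GeomType.sign, hk.neg_one_pow]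
    · rw [hodd k hk, smul_zero]
  intro ℓ n
  have hlim : Tendsto (fun N => MvPowerSeries.coeff n (formalExpLin d τ N (diracPoly τ ℓ))) atTop
      (𝓝 (MvPowerSeries.coeff n (momentConv m ℓ))) := by
    have : momentConv m ℓ = ∑ k ∈ Finset.range (ℓ + 1),
        ((ℓ.choose k : ℝ) * τ.sign ^ k) • (m (ℓ - k) * m k) := by
      refine Finset.sum_congr rfl fun k _ => ?_
      rw [mul_smul, ← mul_smul_comm, hsign, Nat.cast_smul_eq_nsmul, nsmul_eq_mul]
    rw [this]
    simp only [diracPoly, map_sum, map_smul]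
    refine tendsto_finsetSum _ fun k _ => Tendsto.const_mul _ ?_
    exact (formalExpLin_solvesLoopEquations d τ).tendsto_coeff_mul
      (fun n => by simpa only [matMoment_eq] using hm (ℓ - k) n)
      (fun n => by simpa only [matMoment_eq] using hm k n) n
  refine hlim.congr' ?_
  filter_upwards [eventually_gt_atTop 0] with N hN
  rw [diracMoment_eq d τ hN]

end DiracEnsemble

/-! ### Evaluation of formal moments at the couplings -/

namespace DiracEnsemble

/-- This is the Cauchy product over exponents; summability in ℝ is absolute, which justifies the
rearrangement. -/
theorem hasSum_coeff_mul {σ : Type*} {f g : MvPowerSeries σ ℝ} {c : σ → ℝ} {a b : ℝ}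
    (hf : HasSum (fun n => MvPowerSeries.coeff n f * n.prod fun i k => c i ^ k) a)
    (hg : HasSum (fun n => MvPowerSeries.coeff n g * n.prod fun i k => c i ^ k) b) :
    HasSum (fun n => MvPowerSeries.coeff n (f * g) * n.prod fun i k => c i ^ k) (a * b) := by
  classical
  set u : (σ →₀ ℕ) → ℝ := fun n => MvPowerSeries.coeff n f * n.prod fun i k => c i ^ k with hu
  set v : (σ →₀ ℕ) → ℝ := fun n => MvPowerSeries.coeff n g * n.prod fun i k => c i ^ k with hv
  have huv := summable_mul_of_summable_norm hf.summable.norm hg.summable.norm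
  have hs := (summable_sum_mul_antidiagonal_of_summable_mul huv).hasSum
  rw [← hf.summable.tsum_mul_tsum_eq_tsum_sum_antidiagonal hg.summable huv, hf.tsum_eq,
    hg.tsum_eq] at hs
  have he : (fun n => MvPowerSeries.coeff n (f * g) * n.prod fun i k => c i ^ k) =
      fun n => ∑ p ∈ Finset.HasAntidiagonal.antidiagonal n, u p.1 * v p.2 := by
    funext n
    rw [MvPowerSeries.coeff_mul, Finset.sum_mul]
    refine Finset.sum_congr rfl fun p hp => ?_
    have hprod : (n.prod fun i k => c i ^ k) =
        (p.1.prod fun i k => c i ^ k) * p.2.prod fun i k => c i ^ k := by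
      rw [← Finset.HasAntidiagonal.mem_antidiagonal.1 hp]
      exact Finsupp.prod_add_index' (fun i => pow_zero (c i)) fun i k l => pow_add (c i) k l
    rw [hprod, hu, hv]
    ring
  rw [he]
  exact hs

theorem hasSum_coeff_momentConv {σ : Type*} {m : ℕ → MvPowerSeries σ ℝ} {c : σ → ℝ} {a : ℕ → ℝ}
    (h : ∀ ℓ, HasSum (fun n => MvPowerSeries.coeff n (m ℓ) * n.prod fun i k => c i ^ k) (a ℓ))
    (ℓ : ℕ) :
    HasSum (fun n => MvPowerSeries.coeff n (momentConv m ℓ) * n.prod fun i k => c i ^ k)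
      (momentConv a ℓ) := by
  have := hasSum_sum (s := Finset.range (ℓ + 1)) fun k _ =>
    (hasSum_coeff_mul (h (ℓ - k)) (h k)).mul_left (ℓ.choose k : ℝ)
  have he : (fun n => MvPowerSeries.coeff n (momentConv m ℓ) * n.prod fun i k => c i ^ k) =
      fun n => ∑ k ∈ Finset.range (ℓ + 1), (ℓ.choose k : ℝ) *
        (MvPowerSeries.coeff n (m (ℓ - k) * m k) * n.prod fun i k => c i ^ k) := by
    funext n
    rw [momentConv, map_sum, Finset.sum_mul]
    refine Finset.sum_congr rfl fun k _ => ?_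
    rw [← nsmul_eq_mul, map_nsmul, nsmul_eq_mul, mul_assoc]
  rw [he]
  exact this

/-! ### Moments of the self-convolution -/

section Convolution

variable {ρ : ℝ → ℝ}

theorem ae_integrable_selfConv (h : Integrable ρ) :
    ∀ᵐ x : ℝ, Integrable fun u : ℝ => ρ (x - u) * ρ u := by
  filter_upwards [h.ae_convolution_exists (ContinuousLinearMap.mul ℝ ℝ) h] with x hx
  refine hx.congr (Eventually.of_forall fun u => ?_)
  simp [mul_comm]

theorem selfConv_nonneg (h : ∀ᵐ x : ℝ, 0 ≤ ρ x) (x : ℝ) : 0 ≤ selfConv ρ x := by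
  refine integral_nonneg_of_ae ?_
  filter_upwards [h, (Measure.measurePreserving_sub_left volume x).quasiMeasurePreserving.ae h]
    with u h1 h2
  exact mul_nonneg h2 h1

/-- Expand x^ℓ = (u + (x - u))^ℓ under the integral. The equality is only almost everywhere because
splitting the integral needs every one of the convolutions to exist at x. -/
theorem pow_mul_selfConv_ae_eq (h : ∀ ℓ : ℕ, Integrable fun x : ℝ => x ^ ℓ * ρ x) (ℓ : ℕ) :
    (fun x => x ^ ℓ * selfConv ρ x) =ᵐ[volume] fun x => ∑ k ∈ Finset.range (ℓ + 1),
      (ℓ.choose k : ℝ) * convolution (fun y => y ^ k * ρ y) (fun y => y ^ (ℓ - k) * ρ y)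
        (ContinuousLinearMap.mul ℝ ℝ) volume x := by
  have hall : ∀ᵐ x : ℝ, ∀ k : ℕ, ConvolutionExistsAt (fun y => y ^ k * ρ y)
      (fun y => y ^ (ℓ - k) * ρ y) x (ContinuousLinearMap.mul ℝ ℝ) volume :=
    ae_all_iff.2 fun k => (h k).ae_convolution_exists _ (h (ℓ - k))
  filter_upwards [hall] with x hx
  simp only [convolution_def, ← integral_const_mul]
  rw [selfConv, ← integral_const_mul,
    ← integral_finsetSum _ fun k _ => (hx k).integrable.const_mul _]
  congr 1
  funext u
  have := add_pow u (x - u) ℓ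
  rw [add_sub_cancel] at this
  rw [this, Finset.sum_mul]
  refine Finset.sum_congr rfl fun k _ => ?_
  simp only [ContinuousLinearMap.mul_apply']
  ring

theorem integrable_pow_mul_selfConv (h : ∀ ℓ : ℕ, Integrable fun x : ℝ => x ^ ℓ * ρ x) (ℓ : ℕ) :
    Integrable fun x => x ^ ℓ * selfConv ρ x :=
  (integrable_finsetSum _ fun k _ =>
    ((h k).integrable_convolution _ (h (ℓ - k))).const_mul _).congr
    (pow_mul_selfConv_ae_eq h ℓ).symm

theorem integral_pow_mul_selfConv (h : ∀ ℓ : ℕ, Integrable fun x : ℝ => x ^ ℓ * ρ x) (ℓ : ℕ) :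
    ∫ x, x ^ ℓ * selfConv ρ x = momentConv (fun k => ∫ x, x ^ k * ρ x) ℓ := by
  rw [integral_congr_ae (pow_mul_selfConv_ae_eq h ℓ), integral_finsetSum _ fun k _ =>
    ((h k).integrable_convolution _ (h (ℓ - k))).const_mul _]
  refine Finset.sum_congr rfl fun k _ => ?_
  rw [integral_const_mul, integral_convolution _ (h k) (h (ℓ - k)),
    ContinuousLinearMap.mul_apply', mul_comm (∫ x, x ^ k * ρ x)]

theorem exists_selfConv_eq_zero (h : HasCompactSupport ρ) :
    ∃ R, ∀ x, R < |x| → selfConv ρ x = 0 := by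
  obtain ⟨R, -, hR⟩ := h.isCompact.isBounded.exists_pos_norm_le
  have hz : ∀ x, R < |x| → ρ x = 0 := fun x hx =>
    image_eq_zero_of_notMem_tsupport fun hm => (hR x hm).not_gt hx
  refine ⟨2 * R, fun x hx => ?_⟩
  have : ∀ u, ρ (x - u) * ρ u = 0 := by
    intro u
    by_cases hu : R < |u|
    · rw [hz u hu, mul_zero]
    · rw [hz (x - u), zero_mul]
      have := abs_sub_abs_le_abs_sub x u
      linarith
  simp [selfConv, this]

end Convolution

/-! ### Moment determinacy -/

section Determinacy

variable {f g : ℝ → ℝ} {M R : ℝ}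

/-- The exponential series may be integrated term by term, since the factorial beats the geometric
growth of the absolute moments. Bounds on even moments suffice for this, by |x|^k ≤ 1 + x^(2k). -/
theorem hasSum_charFun (h0 : ∀ᵐ x : ℝ, 0 ≤ f x)
    (hi : ∀ ℓ : ℕ, Integrable fun x : ℝ => x ^ ℓ * f x)
    (hb : ∀ k : ℕ, ∫ x : ℝ, x ^ (2 * k) * f x ≤ M * R ^ (2 * k)) (t : ℝ) :
    HasSum (fun k : ℕ => (t * Complex.I) ^ k / (k.factorial : ℂ) * ((∫ x, x ^ k * f x : ℝ) : ℂ))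
      (∫ x : ℝ, Complex.exp (t * x * Complex.I) * (f x : ℂ)) := by
  have hF : ∀ k : ℕ, Integrable fun x : ℝ =>
      (t * Complex.I) ^ k / (k.factorial : ℂ) * ((x ^ k * f x : ℝ) : ℂ) :=
    fun k => Integrable.const_mul (hi k).ofReal _
  have hn : ∀ k : ℕ, ∫ x : ℝ, ‖(t * Complex.I) ^ k / (k.factorial : ℂ) *
      ((x ^ k * f x : ℝ) : ℂ)‖ = |t| ^ k / k.factorial * ∫ x : ℝ, |x ^ k * f x| := by
    intro k
    rw [← integral_const_mul]
    simp
  have hle : ∀ k : ℕ, ∫ x : ℝ, |x ^ k * f x| ≤ (∫ x, f x) + M * R ^ (2 * k) := by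
    intro k
    have hf : Integrable f := by simpa using hi 0
    refine le_trans ?_ (add_le_add_right (hb k) _)
    rw [← integral_add hf (hi (2 * k))]
    refine integral_mono_ae (hi k).abs (hf.add (hi (2 * k))) ?_
    filter_upwards [h0] with x hx
    rw [abs_mul, abs_of_nonneg hx, abs_pow, pow_mul', ← sq_abs (x ^ k), abs_pow]
    nlinarith [sq_nonneg (|x| ^ k - 1), mul_nonneg hx (sq_nonneg (|x| ^ k)),
      mul_nonneg hx (sq_nonneg (|x| ^ k - 1))]
  have hs : Summable fun k : ℕ => ∫ x : ℝ, ‖(t * Complex.I) ^ k / (k.factorial : ℂ) *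
      ((x ^ k * f x : ℝ) : ℂ)‖ := by
    have h1 := (Real.summable_pow_div_factorial |t|).mul_right (∫ x, f x)
    have h2 := (Real.summable_pow_div_factorial (|t| * R ^ 2)).mul_right M
    refine Summable.of_nonneg_of_le (fun k => integral_nonneg fun _ => norm_nonneg _)
      (fun k => ?_) (h1.add h2)
    rw [hn]
    refine (mul_le_mul_of_nonneg_left (hle k) (by positivity)).trans (le_of_eq ?_)
    rw [mul_pow, pow_mul]
    ring
  have := hasSum_integral_of_summable_integral_norm hF hs
  simp only [integral_const_mul, integral_complex_ofReal] at this
  have hexp : ∀ x : ℝ, Complex.exp (t * x * Complex.I) * (f x : ℂ) =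
      ∑' k : ℕ, (t * Complex.I) ^ k / (k.factorial : ℂ) * ((x ^ k * f x : ℝ) : ℂ) := by
    intro x
    have he := (NormedSpace.expSeries_div_hasSum_exp (t * x * Complex.I : ℂ)).mul_right (f x : ℂ)
    rw [← Complex.exp_eq_exp_ℂ] at he
    rw [← he.tsum_eq]
    congr 1
    funext k
    push_cast
    rw [mul_right_comm, mul_pow]
    ring
  simp only [hexp]
  exact this

/-- Two densities with the same moments agree if these grow at most exponentially. -/
theorem ae_eq_of_moments_eq (hf0 : ∀ᵐ x : ℝ, 0 ≤ f x) (hg0 : ∀ᵐ x : ℝ, 0 ≤ g x)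
    (hf : ∀ ℓ : ℕ, Integrable fun x : ℝ => x ^ ℓ * f x)
    (hg : ∀ ℓ : ℕ, Integrable fun x : ℝ => x ^ ℓ * g x)
    (h : ∀ ℓ : ℕ, ∫ x : ℝ, x ^ ℓ * f x = ∫ x : ℝ, x ^ ℓ * g x)
    (hb : ∀ k : ℕ, ∫ x : ℝ, x ^ (2 * k) * g x ≤ M * R ^ (2 * k)) : f =ᵐ[volume] g := by
  have key : ∀ q : ℝ → ℝ, (∀ᵐ x : ℝ, 0 ≤ q x) → Integrable q → ∀ t : ℝ,
      charFun (volume.withDensity fun x => ENNReal.ofReal (q x)) t =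
        ∫ x : ℝ, Complex.exp (t * x * Complex.I) * (q x : ℂ) := by
    intro q hq0 hq t
    rw [charFun_apply_real, integral_withDensity_eq_integral_toReal_smul₀
      hq.aestronglyMeasurable.aemeasurable.ennreal_ofReal (by simp)]
    refine integral_congr_ae ?_
    filter_upwards [hq0] with x hx
    simp only [ENNReal.toReal_ofReal hx, Complex.real_smul, mul_comm]
  have hf1 : Integrable f := by simpa using hf 0
  have hg1 : Integrable g := by simpa using hg 0
  have : IsFiniteMeasure (volume.withDensity fun x => ENNReal.ofReal (f x)) :=
    isFiniteMeasure_withDensity_ofReal hf1.2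
  have : IsFiniteMeasure (volume.withDensity fun x => ENNReal.ofReal (g x)) :=
    isFiniteMeasure_withDensity_ofReal hg1.2
  have hμ : (volume.withDensity fun x => ENNReal.ofReal (f x)) =
      volume.withDensity fun x => ENNReal.ofReal (g x) := by
    refine Measure.ext_of_charFun (funext fun t => ?_)
    rw [key f hf0 hf1, key g hg0 hg1]
    -- Equal moments transfer the growth bound from g to f, so the competing density needs no
    -- support condition.
    have h1 := hasSum_charFun hf0 hf (fun k => (h (2 * k)).trans_le (hb k)) t
    simp only [h] at h1
    exact h1.unique (hasSum_charFun hg0 hg hb t)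
  rw [withDensity_eq_iff_of_sigmaFinite hf1.aestronglyMeasurable.aemeasurable.ennreal_ofReal
    hg1.aestronglyMeasurable.aemeasurable.ennreal_ofReal] at hμ
  filter_upwards [hμ, hf0, hg0] with x hx h1 h2
  exact (ENNReal.ofReal_eq_ofReal_iff h1 h2).1 hx

end Determinacy

namespace IsLimitingDensity

variable {σ : Type*} {E : ℕ → ℕ → MvPowerSeries σ ℝ} {c : σ → ℝ} {ρ ρ' : ℝ → ℝ}

theorem integral_pow_mul_eq (h : IsLimitingDensity E c ρ) (h' : IsLimitingDensity E c ρ')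
    (ℓ : ℕ) : ∫ x : ℝ, x ^ ℓ * ρ x = ∫ x : ℝ, x ^ ℓ * ρ' x := by
  obtain ⟨m, hm, hs⟩ := h.moments
  obtain ⟨m', hm', hs'⟩ := h'.moments
  have : m ℓ = m' ℓ := MvPowerSeries.ext fun n => tendsto_nhds_unique (hm ℓ n) (hm' ℓ n)
  exact (hs ℓ).unique (this ▸ hs' ℓ)

/-- A limiting density of bounded support is unique. -/
theorem ae_eq (h : IsLimitingDensity E c ρ) (h' : IsLimitingDensity E c ρ') {R : ℝ}
    (hz : ∀ x, R < |x| → ρ x = 0) : ρ' =ᵐ[volume] ρ := by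
  -- M is the total mass of ρ, and x^(2k) ≤ R^(2k) wherever ρ can be nonzero.
  refine ae_eq_of_moments_eq (M := 1) (R := R) h'.nonneg h.nonneg h'.integrable h.integrable
    (h'.integral_pow_mul_eq h) fun k => ?_
  have hi : Integrable ρ := by simpa using h.integrable 0
  rw [← h.integral_eq_one, mul_comm (∫ x, ρ x), ← integral_const_mul]
  refine integral_mono_ae (h.integrable _) (hi.const_mul _) ?_
  filter_upwards [h.nonneg] with x hx
  by_cases hx' : R < |x|
  · simp [hz x hx']
  · refine mul_le_mul_of_nonneg_right ?_ hx
    rw [pow_mul, pow_mul, ← sq_abs x]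
    have := not_lt.1 hx'
    gcongr

end IsLimitingDensity

theorem isLimitingDensity_selfConv {τ : GeomType} {d : ℕ} {c : Coupling d → ℝ} {ρ : ℝ → ℝ}
    (h : IsLimitingDensity (matMoment d τ) c ρ) :
    IsLimitingDensity (diracMoment d τ) c (selfConv ρ) where
  nonneg := Eventually.of_forall (selfConv_nonneg h.nonneg)
  integrable := integrable_pow_mul_selfConv h.integrable
  integral_eq_one := by
    have := integral_pow_mul_selfConv h.integrable 0
    simpa [momentConv, h.integral_eq_one] using this
  moments := by
    obtain ⟨m, hm, hs⟩ := h.moments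
    refine ⟨momentConv m, isFormalLimit_diracMoment hm, fun ℓ => ?_⟩
    rw [integral_pow_mul_selfConv h.integrable]
    exact hasSum_coeff_momentConv hs ℓ

end DiracEnsemble

end

theorem theorem2p1 (τ : DiracEnsemble.GeomType) (d : ℕ) :
    (∀ m : ℕ → MvPowerSeries (DiracEnsemble.Coupling d) ℝ,
      DiracEnsemble.IsFormalLimit (DiracEnsemble.matMoment d τ) m →
      DiracEnsemble.IsFormalLimit (DiracEnsemble.diracMoment d τ)
        (DiracEnsemble.momentConv m)) ∧
    (∀ (t : ℕ → ℝ) (ρ : ℝ → ℝ),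
      DiracEnsemble.IsLimitingDensity (DiracEnsemble.matMoment d τ)
        (DiracEnsemble.couplingVal d t) ρ →
      (∀ᵐ x : ℝ, Integrable fun u : ℝ => ρ (x - u) * ρ u) ∧
      DiracEnsemble.IsLimitingDensity (DiracEnsemble.diracMoment d τ)
        (DiracEnsemble.couplingVal d t) (DiracEnsemble.selfConv ρ) ∧
      (HasCompactSupport ρ → ∀ ρ' : ℝ → ℝ,
        DiracEnsemble.IsLimitingDensity (DiracEnsemble.diracMoment d τ)
          (DiracEnsemble.couplingVal d t) ρ' →
        ρ' =ᵐ[volume] DiracEnsemble.selfConv ρ)) := by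
  refine ⟨fun m hm => DiracEnsemble.isFormalLimit_diracMoment hm, fun t ρ h => ?_⟩
  have hconv := DiracEnsemble.isLimitingDensity_selfConv h
  refine ⟨DiracEnsemble.ae_integrable_selfConv (by simpa using h.integrable 0), hconv,
    fun hρ ρ' h' => ?_⟩
  obtain ⟨R, hz⟩ := DiracEnsemble.exists_selfConv_eq_zero hρ
  exact hconv.ae_eq h' hz
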